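/- Let $\mu^{(k)}$, $k\in\mathbb N_0$, be finite non-negative Borel measures on $\mathbb R$, each with bounded and infinite support. Let $p_l^{(k)}$, $l\in\mathbb N_0$, be the orthonormal polynomials of $\mu^{(k)}$ ($\deg p_l^{(k)}=l$, positive leading coefficient), with three-term recurrence $x\,p_l^{(k)}=b_{l+1}^{(k)}p_{l+1}^{(k)}+a_l^{(k)}p_l^{(k)}+b_l^{(k)}p_{l-1}^{(k)}$, where $p_{-1}^{(k)}=0$ and $b_0^{(k)}=0$. Let $a\in\mathbb R$, $b>0$, and assume that the family is in the uniform Nevai class $M^{(U)}(a,b)$, i.e. $$\lim_{n\to\infty}\sup_{k\in\mathbb N_0}|a_n^{(k)}-a|=0,\qquad \lim_{n\to\infty}\sup_{k\in\mathbb N_0}|b_n^{(k)}-b|=0$$ (suprema in $[0,\infty]$). Let $(\sigma_n)_{n\ge0}$, $(\tau_n)_{n\ge0}$ be non-negative sequences defining a regular Nörlund method with weights $\sigma_{n,k}=\tau_n\sigma_{n-k}$, $0\le k\le n$; that is, $\sigma_{n,k}\ge 0$, $\sum_{k=0}^n\sigma_{n,k}=1$ for every $n$, and $\lim_{n\to\infty}\sigma_{n,k}=0$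 for every $k$. Put $N_n=\tau_n\sum_{k=0}^n\tau_k^{-1}$ and assume $N_n\to\infty$. With $K_n^{(k)}(x,y)=\sum_{l=0}^n p_l^{(k)}(x)p_l^{(k)}(y)$ define $$d\lambda_n=\frac1{N_n}\sum_{k=0}^n\sigma_{n,k}\,K_k^{(n-k)}(x,x)\,d\mu^{(n-k)},\qquad \nu_{n+1}=\frac1{N_n}\sum_{k=0}^n\sigma_{n,k}\sum_{j=1}^{k+1}\delta_{x_{k+1,j}^{(n-k)}},$$ where $x_{k+1,1}^{(n-k)}<\dots<x_{k+1,k+1}^{(n-k)}$ are the zeros of $p_{k+1}^{(n-k)}$. Then $\lambda_n$, $\nu_{n+1}$ and the arcsine distribution $$d\mu_\Sigma=\frac1\pi\,\frac{\chi_{[a-2b,a+2b]}(x)}{\sqrt{4b^2-(x-a)^2}}\,dx$$ are probability measures, and both $\lambda_n$ and $\nu_{n+1}$ converge weakly to $\mu_\Sigma$ as $n\to\infty$ (that is, $\int f\,d\lambda_n\to\int f\,d\mu_\Sigma$ and $\int f\,d\nu_{n+1}\to\int f\,d\mu_\Sigma$ for every bounded continuous $f$). If moreover $\sup_{n,k}|a_n^{(k)}|<\infty$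 and $\sup_{n,k}|b_n^{(k)}|<\infty$, then these limits hold for every continuous $f:\mathbb R\to\mathbb R$. -/

import Mathlib

open MeasureTheory Filter Topology Polynomial
open scoped BoundedContinuousFunction ENNReal

/-! ### Orthonormal polynomials and their recurrence coefficients -/

/-- The measures under consideration: finite, with bounded and infinite support, so that orthonormal
polynomials of every degree exist. -/
structure IsAdmissible (μ : Measure ℝ) : Prop where
  finite : IsFiniteMeasure μ
  bounded : Bornology.IsBounded μ.support
  infinite : μ.support.Infinite

/-- The monic orthogonal polynomials of `μ`, by the Gram-Schmidt process applied to `1, X, X², …`. -/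
noncomputable def monicOrthoPoly (μ : Measure ℝ) : ℕ → ℝ[X]
  | n => X ^ n - ∑ j : Fin n,
      C ((∫ x, x ^ n * (monicOrthoPoly μ j).eval x ∂μ) /
        ∫ x, ((monicOrthoPoly μ j).eval x) ^ 2 ∂μ) * monicOrthoPoly μ j
  termination_by n => n
  decreasing_by all_goals exact j.2

/-- The orthonormal polynomial `p_n` of degree `n`, with positive leading coefficient. -/
noncomputable def orthoPoly (μ : Measure ℝ) (n : ℕ) : ℝ[X] :=
  C (√(∫ x, ((monicOrthoPoly μ n).eval x) ^ 2 ∂μ))⁻¹ * monicOrthoPoly μ n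

/-- The diagonal recurrence coefficient `a_n = ∫ x p_n² dμ`. -/
noncomputable def recurrenceA (μ : Measure ℝ) (n : ℕ) : ℝ :=
  ∫ x, x * ((orthoPoly μ n).eval x) ^ 2 ∂μ

/-- The off-diagonal recurrence coefficient `b_n = ∫ x p_{n-1} p_n dμ` for `n ≥ 1`; `b_0 = 0`. -/
noncomputable def recurrenceB (μ : Measure ℝ) : ℕ → ℝ
  | 0 => 0
  | n + 1 => ∫ x, x * (orthoPoly μ n).eval x * (orthoPoly μ (n + 1)).eval x ∂μ

/-! The following facts confirm that these are the orthonormal polynomials and the coefficients of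
their three-term recurrence. -/

theorem IsAdmissible.integrable_continuous {μ : Measure ℝ} (h : IsAdmissible μ) {f : ℝ → ℝ}
    (hf : Continuous f) : Integrable f μ := by
  have := h.finite
  have hK : IsCompact μ.support := Metric.isCompact_of_isClosed_isBounded
    Measure.isClosed_support h.bounded
  obtain ⟨M, hM⟩ := hK.exists_bound_of_continuousOn hf.continuousOn
  refine Integrable.of_bound hf.aestronglyMeasurable M ?_
  filter_upwards [Measure.support_mem_ae (μ := μ)] with x hx using hM x hx

theorem IsAdmissible.integral_sq_pos {μ : Measure ℝ} (h : IsAdmissible μ) {p : ℝ[X]}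
    (hp : p ≠ 0) : 0 < ∫ x, (p.eval x) ^ 2 ∂μ := by
  refine lt_of_le_of_ne (integral_nonneg fun x => sq_nonneg _) fun h0 => ?_
  rw [eq_comm, integral_eq_zero_iff_of_nonneg (fun x => sq_nonneg _)
    (h.integrable_continuous (p.continuous.pow 2))] at h0
  have hcl : IsClosed {x : ℝ | p.eval x = 0} :=
    isClosed_eq p.continuous continuous_const
  have hsub : μ.support ⊆ {x : ℝ | p.eval x = 0} := by
    refine Measure.support_subset_of_isClosed hcl ?_
    filter_upwards [h0] with x hx
    simpa using hx
  refine h.infinite (Set.Finite.subset (p.roots.toFinset.finite_toSet) ?_)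
  intro x hx
  simpa [hp] using hsub hx

theorem monicOrthoPoly_eq (μ : Measure ℝ) (n : ℕ) :
    monicOrthoPoly μ n = X ^ n - ∑ j : Fin n,
      C ((∫ x, x ^ n * (monicOrthoPoly μ j).eval x ∂μ) /
        ∫ x, ((monicOrthoPoly μ j).eval x) ^ 2 ∂μ) * monicOrthoPoly μ j := by
  rw [monicOrthoPoly]

theorem monicOrthoPoly_monic_degree (μ : Measure ℝ) (n : ℕ) :
    (monicOrthoPoly μ n).Monic ∧ (monicOrthoPoly μ n).degree = n := by
  induction n using Nat.strong_induction_on with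
  | _ n ih =>
    have hlt : (∑ j : Fin n,
      C ((∫ x, x ^ n * (monicOrthoPoly μ j).eval x ∂μ) /
        ∫ x, ((monicOrthoPoly μ j).eval x) ^ 2 ∂μ) * monicOrthoPoly μ j).degree < n := by
      refine (degree_sum_le _ _).trans_lt ?_
      refine (Finset.sup_lt_iff (WithBot.bot_lt_coe n)).2 ?_
      intro j _
      rw [← smul_eq_C_mul]
      refine (degree_smul_le _ _).trans_lt ?_
      rw [(ih j j.2).2]
      exact WithBot.coe_lt_coe.2 j.2
    rw [monicOrthoPoly_eq]
    exact ⟨(monic_X_pow n).sub_of_left (by simpa using hlt),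
      by rw [degree_sub_eq_left_of_degree_lt (by simpa using hlt)]; simp⟩

theorem IsAdmissible.monicOrthoPoly_orthogonal {μ : Measure ℝ} (h : IsAdmissible μ) (n : ℕ) :
    ∀ i < n, ∫ x, (monicOrthoPoly μ n).eval x * (monicOrthoPoly μ i).eval x ∂μ = 0 := by
  induction n using Nat.strong_induction_on with
  | _ n ih =>
    intro i hi
    have key : ∀ j : Fin n, j ≠ ⟨i, hi⟩ →
        ∫ x, (monicOrthoPoly μ j).eval x * (monicOrthoPoly μ i).eval x ∂μ = 0 := by
      intro j hj
      rcases lt_trichotomy (j : ℕ) i with hlt | heq | hgt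
      · simpa only [mul_comm] using ih i hi j hlt
      · exact absurd (Fin.ext heq) hj
      · exact ih j j.2 i hgt
    have hpos := h.integral_sq_pos (monicOrthoPoly_monic_degree μ i).1.ne_zero
    rw [monicOrthoPoly_eq μ n]
    simp only [eval_sub, eval_pow, eval_X, eval_finsetSum, eval_mul, eval_C, sub_mul,
      Finset.sum_mul]
    rw [integral_sub (h.integrable_continuous (by fun_prop))
      (h.integrable_continuous (by fun_prop)),
      integral_finsetSum _ (fun j _ => h.integrable_continuous (by fun_prop))]
    simp only [mul_assoc, integral_const_mul]
    rw [Finset.sum_eq_single (⟨i, hi⟩ : Fin n) (fun j _ hj => by rw [key j hj, mul_zero])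
      (by simp)]
    simp only [← sq]
    field_simp
    simp

theorem IsAdmissible.orthoPoly_degree {μ : Measure ℝ} (h : IsAdmissible μ) (n : ℕ) :
    (orthoPoly μ n).degree = n ∧ 0 < (orthoPoly μ n).leadingCoeff := by
  have hm := monicOrthoPoly_monic_degree μ n
  have hpos : 0 < (√(∫ x, ((monicOrthoPoly μ n).eval x) ^ 2 ∂μ))⁻¹ :=
    inv_pos.2 (Real.sqrt_pos.2 (h.integral_sq_pos hm.1.ne_zero))
  constructor
  · rw [orthoPoly, degree_C_mul hpos.ne', hm.2]
  · rw [orthoPoly, leadingCoeff_mul, leadingCoeff_C, hm.1.leadingCoeff, mul_one]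
    exact hpos

theorem IsAdmissible.orthoPoly_orthonormal {μ : Measure ℝ} (h : IsAdmissible μ) (m n : ℕ) :
    ∫ x, (orthoPoly μ m).eval x * (orthoPoly μ n).eval x ∂μ = if m = n then 1 else 0 := by
  have e : ∀ x, (orthoPoly μ m).eval x * (orthoPoly μ n).eval x =
      ((√(∫ x, ((monicOrthoPoly μ m).eval x) ^ 2 ∂μ))⁻¹ *
      (√(∫ x, ((monicOrthoPoly μ n).eval x) ^ 2 ∂μ))⁻¹) *
      ((monicOrthoPoly μ m).eval x * (monicOrthoPoly μ n).eval x) := by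
    intro x
    simp only [orthoPoly, eval_mul, eval_C]
    ring
  simp only [e, integral_const_mul]
  rcases lt_trichotomy m n with hlt | rfl | hgt
  · have := h.monicOrthoPoly_orthogonal n m hlt
    simp only [mul_comm (eval _ (monicOrthoPoly μ n))] at this
    simp [this, hlt.ne]
  · have hpos := h.integral_sq_pos (monicOrthoPoly_monic_degree μ m).1.ne_zero
    simp only [← sq, if_true]
    rw [← Real.sqrt_inv, Real.sq_sqrt (inv_nonneg.2 hpos.le), inv_mul_cancel₀ hpos.ne']
  · simp [h.monicOrthoPoly_orthogonal m n hgt, hgt.ne']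

theorem IsAdmissible.orthoPoly_orthogonal_of_degree_lt {μ : Measure ℝ} (h : IsAdmissible μ)
    (p : ℝ[X]) (n : ℕ)
    (hp : ∀ j < n, ∫ x, p.eval x * (orthoPoly μ j).eval x ∂μ = 0) :
    ∀ q : ℝ[X], q.degree < n → ∫ x, p.eval x * q.eval x ∂μ = 0 := by
  induction n with
  | zero =>
    intro q hq
    have : q = 0 := by
      rw [← degree_eq_bot]
      exact Nat.WithBot.lt_zero_iff.1 (by simpa using hq)
    simp [this]
  | succ n ih =>
    intro q hq
    obtain ⟨hd, hl⟩ := h.orthoPoly_degree n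
    set c := q.coeff n / (orthoPoly μ n).leadingCoeff with hc
    have hcoef : (orthoPoly μ n).coeff n = (orthoPoly μ n).leadingCoeff := by
      rw [leadingCoeff, natDegree_eq_of_degree_eq_some hd]
    have hr : (q - C c * orthoPoly μ n).degree < n := by
      rw [degree_lt_iff_coeff_zero]
      intro m hm
      rcases hm.lt_or_eq with hm | rfl
      · rw [coeff_sub, coeff_C_mul, coeff_eq_zero_of_degree_lt, coeff_eq_zero_of_degree_lt]
        · simp
        · rw [hd]; exact_mod_cast hm
        · exact hq.trans_le (by exact_mod_cast hm)
      · rw [coeff_sub, coeff_C_mul, hcoef, hc, div_mul_cancel₀ _ hl.ne', sub_self]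
    have h1 := ih (fun j hj => hp j (hj.trans n.lt_succ_self)) _ hr
    have h2 := hp n n.lt_succ_self
    have e : ∀ x, p.eval x * q.eval x = p.eval x * (q - C c * orthoPoly μ n).eval x +
        c * (p.eval x * (orthoPoly μ n).eval x) := by
      intro x
      simp only [eval_sub, eval_mul, eval_C]
      ring
    simp only [e]
    rw [integral_add (h.integrable_continuous (by fun_prop))
      (h.integrable_continuous (by fun_prop)), integral_const_mul, h1, h2]
    simp

/-- The three-term recurrence
`x p_n = b_{n+1} p_{n+1} + a_n p_n + b_n p_{n-1}` (the last term is absent for `n = 0`). -/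
theorem IsAdmissible.three_term_recurrence {μ : Measure ℝ} (h : IsAdmissible μ) (n : ℕ) :
    X * orthoPoly μ n = C (recurrenceB μ (n + 1)) * orthoPoly μ (n + 1) +
      C (recurrenceA μ n) * orthoPoly μ n + C (recurrenceB μ n) * orthoPoly μ (n - 1) := by
  have hon := h.orthoPoly_orthonormal
  have hI : ∀ p q : ℝ[X], Integrable (fun x => p.eval x * q.eval x) μ := fun p q =>
    h.integrable_continuous (by fun_prop)
  set q := X * orthoPoly μ n - (C (recurrenceB μ (n + 1)) * orthoPoly μ (n + 1) +
      C (recurrenceA μ n) * orthoPoly μ n + C (recurrenceB μ n) * orthoPoly μ (n - 1)) with hq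
  have hexp : ∀ j, ∫ x, q.eval x * (orthoPoly μ j).eval x ∂μ =
      (∫ x, x * (orthoPoly μ n).eval x * (orthoPoly μ j).eval x ∂μ) -
      (recurrenceB μ (n + 1) * (if n + 1 = j then 1 else 0) +
       recurrenceA μ n * (if n = j then 1 else 0) +
       recurrenceB μ n * (if n - 1 = j then 1 else 0)) := by
    intro j
    have hc : ∀ (c : ℝ) (p r : ℝ[X]), Integrable (fun x => c * (p.eval x * r.eval x)) μ :=
      fun c p r => (hI p r).const_mul c
    have hs : Integrable (fun x =>
        recurrenceB μ (n + 1) * ((orthoPoly μ (n + 1)).eval x * (orthoPoly μ j).eval x) +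
        recurrenceA μ n * ((orthoPoly μ n).eval x * (orthoPoly μ j).eval x)) μ :=
      (hc _ _ _).add (hc _ _ _)
    have hs' : Integrable (fun x =>
        recurrenceB μ (n + 1) * ((orthoPoly μ (n + 1)).eval x * (orthoPoly μ j).eval x) +
        recurrenceA μ n * ((orthoPoly μ n).eval x * (orthoPoly μ j).eval x) +
        recurrenceB μ n * ((orthoPoly μ (n - 1)).eval x * (orthoPoly μ j).eval x)) μ :=
      hs.add (hc _ _ _)
    rw [← hon (n + 1) j, ← hon n j, ← hon (n - 1) j, ← integral_const_mul, ← integral_const_mul,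
      ← integral_const_mul, ← integral_add (hc _ _ _) (hc _ _ _), ← integral_add hs (hc _ _ _),
      ← integral_sub (h.integrable_continuous (by fun_prop)) hs']
    refine integral_congr_ae (Eventually.of_forall fun x => ?_)
    simp only [hq, eval_sub, eval_add, eval_mul, eval_C, eval_X]
    ring
  have hdeg : q.degree < (n + 2 : ℕ) := by
    have hd := fun m => (h.orthoPoly_degree m).1
    rw [hq, degree_lt_iff_coeff_zero]
    intro m hm
    obtain ⟨m, rfl⟩ : ∃ k, m = k + 1 := ⟨m - 1, by omega⟩
    have hz : ∀ i l, i < l → (orthoPoly μ i).coeff l = 0 := fun i l hil =>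
      coeff_eq_zero_of_degree_lt (by rw [hd]; exact_mod_cast hil)
    simp only [coeff_sub, coeff_add, coeff_C_mul, coeff_X_mul]
    rw [hz n m (by omega), hz (n + 1) _ (by omega), hz n _ (by omega), hz (n - 1) _ (by omega)]
    simp
  have horth : ∀ j < n + 2, ∫ x, q.eval x * (orthoPoly μ j).eval x ∂μ = 0 := by
    intro j hj
    rw [hexp]
    rcases Nat.lt_or_ge j n with hjn | hjn
    · rcases eq_or_ne (j + 1) n with rfl | hne
      · have e : ∀ x, x * (orthoPoly μ (j + 1)).eval x * (orthoPoly μ j).eval x =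
            x * (orthoPoly μ j).eval x * (orthoPoly μ (j + 1)).eval x := fun x => by ring
        simp only [e]
        simp [recurrenceB]
        omega
      · have := h.orthoPoly_orthogonal_of_degree_lt (orthoPoly μ n) n (fun i hi => by
          rw [hon, if_neg hi.ne']) (X * orthoPoly μ j) (by
            rw [degree_mul, degree_X, (h.orthoPoly_degree j).1]
            have : 1 + j < n := by omega
            exact_mod_cast this)
        have e : ∀ x, x * (orthoPoly μ n).eval x * (orthoPoly μ j).eval x =
            (orthoPoly μ n).eval x * (X * orthoPoly μ j).eval x := fun x => by
          simp only [eval_mul, eval_X]; ring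
        simp only [e]
        rw [this, if_neg (by omega), if_neg (by omega), if_neg (by omega)]
        simp
    · obtain rfl | rfl : j = n ∨ j = n + 1 := by omega
      · rcases j with _ | j
        · simp [recurrenceB, recurrenceA, sq, mul_assoc]
        · simp [recurrenceA, sq, mul_assoc]
      · rw [if_pos rfl, if_neg (by omega), if_neg (by omega), recurrenceB]
        simp
  have hzero := h.orthoPoly_orthogonal_of_degree_lt q (n + 2) horth q hdeg
  have : q = 0 := by
    by_contra hne
    have := h.integral_sq_pos hne
    simp only [sq] at this
    exact this.ne' hzero
  rw [hq] at this
  exact sub_eq_zero.1 this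

/-! ### The uniform Nevai class -/

/-- The uniform Nevai class: `lim_{n → ∞} sup_k |a_n^{(k)} - a| = 0` and
`lim_{n → ∞} sup_k |b_n^{(k)} - b| = 0`, the suprema being taken in `[0, ∞]`. -/
def UniformNevai (μ : ℕ → Measure ℝ) (a b : ℝ) : Prop :=
  Tendsto (fun n => ⨆ k, ‖recurrenceA (μ k) n - a‖ₑ) atTop (𝓝 0) ∧
  Tendsto (fun n => ⨆ k, ‖recurrenceB (μ k) n - b‖ₑ) atTop (𝓝 0)

/-! ### Summation methods -/

/-- Regularity of the summation method `(S_n y) = ∑_{k ≤ n} w n k * y k`. -/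
structure IsRegularSummation (w : ℕ → ℕ → ℝ) : Prop where
  nonneg : ∀ n, ∀ k ≤ n, 0 ≤ w n k
  sum_eq_one : ∀ n, ∑ k ∈ Finset.range (n + 1), w n k = 1
  tendsto_zero : ∀ k, Tendsto (fun n => w n k) atTop (𝓝 0)

/-- The Nörlund weights `σ_{n,k} = τ_n σ_{n-k}` (used for `k ≤ n`). -/
def norlundWeight (σ τ : ℕ → ℝ) (n k : ℕ) : ℝ := τ n * σ (n - k)

/-- A regular Nörlund method, given by two non-negative sequences. -/
structure IsRegularNorlund (σ τ : ℕ → ℝ) : Prop where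
  sigma_nonneg : ∀ n, 0 ≤ σ n
  tau_nonneg : ∀ n, 0 ≤ τ n
  regular : IsRegularSummation (norlundWeight σ τ)

/-- The normalization constant `N_n = τ_n ∑_{k ≤ n} 1 / τ_k`. -/
noncomputable def norlundConst (τ : ℕ → ℝ) (n : ℕ) : ℝ :=
  τ n * ∑ k ∈ Finset.range (n + 1), 1 / τ k

/-! ### The mean measures -/

/-- The Christoffel-Darboux kernel `K_n(x, y) = ∑_{l ≤ n} p_l(x) p_l(y)`. -/
noncomputable def cdKernel (μ : Measure ℝ) (n : ℕ) (x y : ℝ) : ℝ :=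
  ∑ l ∈ Finset.range (n + 1), (orthoPoly μ l).eval x * (orthoPoly μ l).eval y

/-- The measure `λ_n = N_n⁻¹ ∑_{k ≤ n} σ_{n,k} K_k^{(n-k)}(x, x) dμ^{(n-k)}`. -/
noncomputable def cdMean (μ : ℕ → Measure ℝ) (σ τ : ℕ → ℝ) (n : ℕ) : Measure ℝ :=
  ENNReal.ofReal (1 / norlundConst τ n) •
    ∑ k ∈ Finset.range (n + 1), ENNReal.ofReal (norlundWeight σ τ n k) •
      (μ (n - k)).withDensity (fun x => ENNReal.ofReal (cdKernel (μ (n - k)) k x x))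

/-- The measure `ν_{n+1} = N_n⁻¹ ∑_{k ≤ n} σ_{n,k} ∑_x δ_x`, where `x` runs over the zeros of
`p_{k+1}^{(n-k)}`. Note that `zeroMean μ σ τ n` is `ν_{n+1}`. -/
noncomputable def zeroMean (μ : ℕ → Measure ℝ) (σ τ : ℕ → ℝ) (n : ℕ) : Measure ℝ :=
  ENNReal.ofReal (1 / norlundConst τ n) •
    ∑ k ∈ Finset.range (n + 1), ENNReal.ofReal (norlundWeight σ τ n k) •
      ∑ x ∈ (orthoPoly (μ (n - k)) (k + 1)).roots.toFinset, Measure.dirac x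

/-- The arcsine distribution on `[a - 2b, a + 2b]`. -/
noncomputable def arcsineMeasure (a b : ℝ) : Measure ℝ :=
  volume.withDensity (fun x => ENNReal.ofReal
    (1 / Real.pi * ((Set.Icc (a - 2 * b) (a + 2 * b)).indicator 1 x /
      √(4 * b ^ 2 - (x - a) ^ 2))))

/-! ### Weak convergence -/

/-- Weak convergence of probability measures: all measures involved are probability measures, and
the sequence converges in the weak topology. -/
def ConvergesWeakly (m : ℕ → Measure ℝ) (m₀ : Measure ℝ) : Prop :=
  ∃ (h : ∀ n, IsProbabilityMeasure (m n)) (h₀ : IsProbabilityMeasure m₀),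
    Tendsto (β := ProbabilityMeasure ℝ) (fun n => ⟨m n, h n⟩) atTop (𝓝 ⟨m₀, h₀⟩)

/-!
The weak limit of the Nörlund means is governed by what happens at a single large index `l`, because
the weights only see averages over `l ≤ k` and the bounded contribution of small indices is divided
by `N_n → ∞`. Here `N_n` is exactly the Nörlund mean of the degrees `k + 1`
(`IsRegularNorlund.sum_norlundWeight_mul`), which also gives all mean measures total mass one; the
resulting averaging principle is `IsRegularNorlund.tendsto_mean`. For this reason the recurrence
coefficients at small indices may be unbounded in `k`.

The measure `λ_n` averages the probability measures `p_l² dμ`, whose `m`-th moment is the diagonal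
entry at `l` of `J^m`, with `J` the Jacobi matrix of `μ`. This entry depends only on the recurrence
coefficients at distance at most `m` from `l`, and for large `l` these are uniformly close to `a`, `b`.
For the constant-coefficient matrix the entries of `J^m` are the Fourier coefficients of
`(a + 2b cos θ)^m`, so the diagonal ones are the moments of the law of `a + 2b cos θ`, which is the
arcsine distribution (`arcsineMeasure_eq_map`). The perturbation estimate is
`exists_abs_sub_arcsineMoment_le`. A quantitative method of moments
(`exists_moments_close_imp_integral_close`) turns it into closeness of `∫ f p_l² dμ` to the arcsine
integral of `f`, uniformly in the measure, for each bounded continuous `f`.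

The zeros of `p_{k+1}` are the eigenvalues of the truncated Jacobi matrix, which are distinct
(`IsAdmissible.exists_eigenvectors_roots`). Expanding `∑ f(x_j)` as a trace writes it as `∑_l ∫ f dρ_l`
with `ρ_l` the spectral measure at the `l`-th unit vector. The low moments of `ρ_l` obey the same
recurrence as before unless `l` is close to `k`, and the boundedly many exceptional `l` are again
harmless. So `ν_{n+1}` is treated by the same estimates as `λ_n`.

If the recurrence coefficients are bounded by `M`, then all measures and zeros lie in a fixed bounded
interval (`IsAdmissible.ae_abs_le`, `IsAdmissible.abs_le_of_mem_roots`), and an arbitrary continuous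
function may be replaced by a bounded one.
-/

/-! ### The arcsine distribution and its moments -/

/-- The uniform probability measure on `(0, π)`. -/
noncomputable def angleMeasure : Measure ℝ :=
  ENNReal.ofReal (1 / Real.pi) • volume.restrict (Set.Ioo 0 Real.pi)

instance isProbabilityMeasure_angleMeasure : IsProbabilityMeasure angleMeasure := by
  constructor
  rw [angleMeasure, Measure.smul_apply, Measure.restrict_apply_univ, Real.volume_Ioo, smul_eq_mul,
    ← ENNReal.ofReal_mul (by positivity), sub_zero, one_div_mul_cancel Real.pi_ne_zero,
    ENNReal.ofReal_one]

theorem integral_angleMeasure (g : ℝ → ℝ) :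
    ∫ θ, g θ ∂angleMeasure = 1 / Real.pi * ∫ θ in (0 : ℝ)..Real.pi, g θ := by
  rw [angleMeasure, integral_smul_measure, ENNReal.toReal_ofReal (by positivity),
    intervalIntegral.integral_of_le Real.pi_pos.le, integral_Ioc_eq_integral_Ioo, smul_eq_mul]

theorem integrable_angleMeasure {g : ℝ → ℝ} (hg : Continuous g) : Integrable g angleMeasure := by
  refine Integrable.smul_measure ?_ (by simp)
  exact (hg.integrableOn_Icc (a := 0) (b := Real.pi)).mono_set Set.Ioo_subset_Icc_self

/-- The arcsine distribution is the law of `a + 2b cos θ` for `θ` uniform on `(0, π)`. -/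
theorem arcsineMeasure_eq_map {a b : ℝ} (hb : 0 < b) :
    arcsineMeasure a b = angleMeasure.map (fun θ => a + 2 * b * Real.cos θ) := by
  have hmeas : Measurable fun θ : ℝ => a + 2 * b * Real.cos θ := by fun_prop
  set φ : ℝ → ℝ := fun θ => a + 2 * b * Real.cos θ with hφ
  set d : ℝ → ℝ≥0∞ := fun x => ENNReal.ofReal
    (1 / Real.pi * ((Set.Icc (a - 2 * b) (a + 2 * b)).indicator 1 x /
      √(4 * b ^ 2 - (x - a) ^ 2))) with hd
  have hinj : Set.InjOn φ (Set.Ioo 0 Real.pi) := by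
    intro x hx y hy hxy
    have : Real.cos x = Real.cos y := by
      have : 2 * b * Real.cos x = 2 * b * Real.cos y := by simpa [hφ] using hxy
      exact mul_left_cancel₀ (by positivity) this
    exact Real.injOn_cos (Set.Ioo_subset_Icc_self hx) (Set.Ioo_subset_Icc_self hy) this
  have hderiv : ∀ x ∈ Set.Ioo 0 Real.pi,
      HasDerivWithinAt φ (-(2 * b * Real.sin x)) (Set.Ioo 0 Real.pi) x := by
    intro x _
    have := ((Real.hasDerivAt_cos x).const_mul (2 * b)).const_add a
    simpa [hφ] using this.hasDerivWithinAt
  have himg : φ '' Set.Ioo 0 Real.pi = Set.Ioo (a - 2 * b) (a + 2 * b) := by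
    ext x
    constructor
    · rintro ⟨θ, hθ, rfl⟩
      have h1 : Real.cos θ < 1 := by
        simpa using Real.cos_lt_cos_of_nonneg_of_le_pi le_rfl hθ.2.le hθ.1
      have h2 : -1 < Real.cos θ := by
        simpa using Real.cos_lt_cos_of_nonneg_of_le_pi hθ.1.le le_rfl hθ.2
      constructor <;> simp only [hφ] <;> nlinarith
    · intro hx
      have h1 : -1 < (x - a) / (2 * b) := by
        rw [lt_div_iff₀ (by positivity)]; linarith [hx.1]
      have h2 : (x - a) / (2 * b) < 1 := by
        rw [div_lt_iff₀ (by positivity)]; linarith [hx.2]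
      refine ⟨Real.arccos ((x - a) / (2 * b)), ⟨Real.arccos_pos.2 h2, ?_⟩, ?_⟩
      · refine lt_of_le_of_ne (Real.arccos_le_pi _) fun h => ?_
        exact absurd (Real.arccos_eq_pi.1 h) (not_le.2 h1)
      · simp only [hφ]
        rw [Real.cos_arccos h1.le h2.le]
        field_simp
        ring
  -- on the curve `x = φ θ` the density is the reciprocal of `π |φ' θ|`
  have hdens : ∀ θ ∈ Set.Ioo 0 Real.pi,
      ENNReal.ofReal |-(2 * b * Real.sin θ)| * d (φ θ) = ENNReal.ofReal (1 / Real.pi) := by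
    intro θ hθ
    have hs := Real.sin_pos_of_mem_Ioo hθ
    have hmem : φ θ ∈ Set.Icc (a - 2 * b) (a + 2 * b) :=
      Set.Ioo_subset_Icc_self (himg ▸ Set.mem_image_of_mem φ hθ)
    have hsq : √(4 * b ^ 2 - (φ θ - a) ^ 2) = 2 * b * Real.sin θ := by
      rw [← Real.sqrt_sq (show 0 ≤ 2 * b * Real.sin θ by positivity)]
      congr 1
      simp only [hφ]
      nlinarith [Real.sin_sq_add_cos_sq θ]
    rw [hd, ← ENNReal.ofReal_mul (abs_nonneg _)]
    rw [Set.indicator_of_mem hmem, hsq, abs_neg, abs_of_pos (by positivity)]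
    congr 1
    simp only [Pi.one_apply]
    field_simp
  refine Measure.ext fun s hs => ?_
  rw [Measure.map_apply hmeas hs, arcsineMeasure, withDensity_apply _ hs]
  have hsupp : ∫⁻ x in s, d x = ∫⁻ x in Set.Ioo (a - 2 * b) (a + 2 * b), s.indicator d x := by
    rw [setLIntegral_indicator hs, ← lintegral_indicator hs, ← lintegral_indicator
      (hs.inter measurableSet_Ioo)]
    refine lintegral_congr fun x => ?_
    by_cases hxs : x ∈ s
    · by_cases hx : x ∈ Set.Ioo (a - 2 * b) (a + 2 * b)
      · rw [Set.indicator_of_mem hxs, Set.indicator_of_mem (Set.mem_inter hxs hx)]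
      · rw [Set.indicator_of_mem hxs, Set.indicator_of_notMem (fun h => hx h.2)]
        by_cases hx' : x ∈ Set.Icc (a - 2 * b) (a + 2 * b)
        -- at the two end points the radicand vanishes, and so does the quotient
        · have : 4 * b ^ 2 - (x - a) ^ 2 = 0 := by
            rcases eq_or_lt_of_le hx'.1 with h | h
            · rw [← h]; ring
            · rcases eq_or_lt_of_le hx'.2 with h' | h'
              · rw [h']; ring
              · exact absurd ⟨h, h'⟩ hx
          simp [hd, this]
        · simp [hd, Set.indicator_of_notMem hx']
    · rw [Set.indicator_of_notMem hxs, Set.indicator_of_notMem (fun h => hxs h.1)]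
  rw [hsupp, ← himg, lintegral_image_eq_lintegral_abs_deriv_mul measurableSet_Ioo hderiv hinj]
  have : ∫⁻ θ in Set.Ioo 0 Real.pi,
      ENNReal.ofReal |-(2 * b * Real.sin θ)| * s.indicator d (φ θ) =
      ∫⁻ θ in Set.Ioo 0 Real.pi, (φ ⁻¹' s).indicator (fun _ => ENNReal.ofReal (1 / Real.pi)) θ := by
    refine setLIntegral_congr_fun measurableSet_Ioo fun θ hθ => ?_
    by_cases h : φ θ ∈ s
    · rw [Set.indicator_of_mem h, Set.indicator_of_mem (show θ ∈ φ ⁻¹' s from h), hdens θ hθ]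
    · rw [Set.indicator_of_notMem h, Set.indicator_of_notMem (show θ ∉ φ ⁻¹' s from h), mul_zero]
  rw [this, lintegral_indicator_const (hmeas hs), angleMeasure, Measure.smul_apply, smul_eq_mul]

theorem isProbabilityMeasure_arcsineMeasure {a b : ℝ} (hb : 0 < b) :
    IsProbabilityMeasure (arcsineMeasure a b) := by
  rw [arcsineMeasure_eq_map hb]
  exact Measure.isProbabilityMeasure_map (by fun_prop)

theorem integral_arcsineMeasure {a b : ℝ} (hb : 0 < b) {g : ℝ → ℝ} (hg : Continuous g) :
    ∫ x, g x ∂(arcsineMeasure a b) = ∫ θ, g (a + 2 * b * Real.cos θ) ∂angleMeasure := by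
  rw [arcsineMeasure_eq_map hb]
  exact integral_map (by fun_prop) hg.aestronglyMeasurable

theorem ae_abs_le_arcsineMeasure {a b : ℝ} (hb : 0 < b) :
    ∀ᵐ x ∂(arcsineMeasure a b), |x| ≤ |a| + 2 * b := by
  rw [arcsineMeasure_eq_map hb, ae_map_iff (by fun_prop) (measurableSet_le (by fun_prop)
    (by fun_prop))]
  refine Eventually.of_forall fun θ => (abs_add_le _ _).trans ?_
  rw [abs_mul, abs_of_pos (by positivity : 0 < 2 * b)]
  nlinarith [Real.abs_cos_le_one θ]

/-- The Fourier coefficient `π⁻¹ ∫₀^π (a + 2b cos θ)^m cos (dθ) dθ`. It is the matrix entry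
`⟨e_{l+d}, J^m e_l⟩` of the bi-infinite Jacobi matrix `J` with constant coefficients `a`, `b`;
for `d = 0` it is the `m`-th moment of the arcsine distribution. -/
noncomputable def arcsineMoment (a b : ℝ) (m : ℕ) (d : ℤ) : ℝ :=
  ∫ θ, (a + 2 * b * Real.cos θ) ^ m * Real.cos (d * θ) ∂angleMeasure

theorem arcsineMoment_zero_right {a b : ℝ} (hb : 0 < b) (m : ℕ) :
    arcsineMoment a b m 0 = ∫ x, x ^ m ∂(arcsineMeasure a b) := by
  rw [integral_arcsineMeasure hb (by fun_prop)]
  simp [arcsineMoment]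

theorem arcsineMoment_zero_left (a b : ℝ) (d : ℤ) :
    arcsineMoment a b 0 d = if d = 0 then 1 else 0 := by
  rw [arcsineMoment]
  split_ifs with h
  · simp [h]
  · have hd : (d : ℝ) ≠ 0 := by exact_mod_cast h
    rw [integral_angleMeasure]
    simp only [pow_zero, one_mul]
    rw [intervalIntegral.integral_comp_mul_left _ hd, integral_cos, mul_zero, Real.sin_zero,
      Real.sin_int_mul_pi]
    simp

theorem arcsineMoment_succ (a b : ℝ) (m : ℕ) (d : ℤ) :
    arcsineMoment a b (m + 1) d = b * arcsineMoment a b m (d + 1) + a * arcsineMoment a b m d +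
      b * arcsineMoment a b m (d - 1) := by
  have hI : ∀ (c : ℝ) (e : ℤ), Integrable
      (fun θ => c * ((a + 2 * b * Real.cos θ) ^ m * Real.cos (e * θ))) angleMeasure :=
    fun c e => integrable_angleMeasure (by fun_prop)
  simp only [arcsineMoment]
  rw [← integral_const_mul, ← integral_const_mul, ← integral_const_mul,
    ← integral_add (hI _ _) (hI _ _)]
  have := integral_add ((hI b (d + 1)).add (hI a d)) (hI b (d - 1))
  simp only [Pi.add_apply] at this
  rw [← this]
  refine integral_congr_ae (Eventually.of_forall fun θ => ?_)
  push_cast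
  simp only [add_mul, sub_mul, one_mul, Real.cos_add, Real.cos_sub]
  ring

theorem abs_arcsineMoment_le {a b : ℝ} (hb : 0 < b) (m : ℕ) (d : ℤ) :
    |arcsineMoment a b m d| ≤ (|a| + 2 * b) ^ m := by
  have := norm_integral_le_of_norm_le_const (μ := angleMeasure)
    (f := fun θ => (a + 2 * b * Real.cos θ) ^ m * Real.cos (d * θ)) (C := (|a| + 2 * b) ^ m)
    (Eventually.of_forall fun θ => by
      rw [Real.norm_eq_abs, abs_mul, abs_pow]
      refine (mul_le_of_le_one_right (by positivity) (Real.abs_cos_le_one _)).trans ?_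
      refine pow_le_pow_left₀ (abs_nonneg _) ((abs_add_le _ _).trans ?_) _
      rw [abs_mul, abs_of_pos (by positivity : 0 < 2 * b)]
      nlinarith [Real.abs_cos_le_one θ])
  simpa [arcsineMoment] using this

/-! ### Moments of Jacobi matrices with nearly constant coefficients -/

/-- If the entries of a Jacobi matrix within distance `r` of the site `l` differ by at most `δ` from
the constants `a` and `b`, then for `m ≤ r` the entries `T m i = ⟨e_i, J^m e_l⟩` near `l` differ
from those of the constant-coefficient matrix by at most a constant times `δ`. The family `T` is
only required to satisfy the recurrence of these entries near `l`. -/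
theorem exists_abs_sub_arcsineMoment_le (a : ℝ) {b : ℝ} (hb : 0 < b) (m : ℕ) :
    ∃ C : ℝ, 0 ≤ C ∧ ∀ (α β : ℕ → ℝ) (δ : ℝ) (l r : ℕ) (T : ℕ → ℕ → ℝ), δ ≤ 1 → r < l →
      (∀ i, l ≤ i + r → |α i - a| ≤ δ ∧ |β i - b| ≤ δ) →
      (∀ i, l ≤ i + r → i ≤ l + r → T 0 i = if i = l then 1 else 0) →
      (∀ n i, l < i + r → i < l + r → T (n + 1) i =
        β (i + 1) * T n (i + 1) + α i * T n i + β i * T n (i - 1)) →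
      ∀ i, l + m ≤ i + r → i + m ≤ l + r →
        |T m i - arcsineMoment a b m (i - l)| ≤ C * δ := by
  induction m with
  | zero =>
    refine ⟨0, le_rfl, fun α β δ l r T _ _ _ h0 _ i hi hi' => ?_⟩
    rw [h0 i (by omega) (by omega), arcsineMoment_zero_left]
    have : ((i : ℤ) - l = 0) ↔ i = l := by omega
    simp [this]
  | succ m ih =>
    obtain ⟨C, hC, h⟩ := ih
    set B := (|a| + 2 * b) ^ m with hB
    have hB0 : 0 ≤ B := by positivity
    refine ⟨(|a| + 2 * b + 3) * C + 3 * B, by positivity,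
      fun α β δ l r T hδ hr hc h0 hs i hi hi' => ?_⟩
    have h' := h α β δ l r T hδ hr hc h0 hs
    have h1 := h' (i + 1) (by omega) (by omega)
    have h2 := h' i (by omega) (by omega)
    have h3 := h' (i - 1) (by omega) (by omega)
    have e1 : (((i + 1 : ℕ) : ℤ) - l) = (i - l : ℤ) + 1 := by push_cast; ring
    have e3 : (((i - 1 : ℕ) : ℤ) - l) = (i - l : ℤ) - 1 := by
      rw [Nat.cast_sub (by omega)]; push_cast; ring
    rw [e1] at h1
    rw [e3] at h3
    have hc1 := (hc (i + 1) (by omega)).2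
    obtain ⟨hc2, hc3⟩ := hc i (by omega)
    rw [hs m i (by omega) (by omega), arcsineMoment_succ]
    have key : ∀ (x y t s u : ℝ), |y| ≤ u → |x - y| ≤ δ → |t - s| ≤ C * δ → |s| ≤ B →
        |x * t - y * s| ≤ (u + 1) * (C * δ) + δ * B := by
      intro x y t s u hy hxy hts hs
      have e : x * t - y * s = x * (t - s) + (x - y) * s := by ring
      have hx : |x| ≤ u + 1 := by
        have := abs_add_le (x - y) y
        rw [sub_add_cancel] at this
        linarith
      rw [e]
      refine (abs_add_le _ _).trans ?_
      rw [abs_mul, abs_mul]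
      exact add_le_add (mul_le_mul hx hts (abs_nonneg _) ((abs_nonneg _).trans hx))
        (mul_le_mul hxy hs (abs_nonneg _) ((abs_nonneg _).trans hxy))
    have k1 := key _ _ _ _ b (abs_of_pos hb).le hc1 h1 (abs_arcsineMoment_le hb _ _)
    have k2 := key _ _ _ _ |a| le_rfl hc2 h2 (abs_arcsineMoment_le hb _ _)
    have k3 := key _ _ _ _ b (abs_of_pos hb).le hc3 h3 (abs_arcsineMoment_le hb _ _)
    rw [abs_le] at k1 k2 k3 ⊢
    constructor <;> linarith [k1.1, k1.2, k2.1, k2.2, k3.1, k3.2]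

/-! ### Weak closeness from closeness of finitely many moments -/

theorem Polynomial.integrable_eval {ρ : Measure ℝ} (p : ℝ[X])
    (h : ∀ i : ℕ, Integrable (fun x => x ^ i) ρ) : Integrable (fun x => p.eval x) ρ := by
  simp only [eval_eq_sum_range]
  exact integrable_finsetSum _ fun i _ => (h i).const_mul _

theorem Polynomial.integral_eval {ρ : Measure ℝ} (p : ℝ[X])
    (h : ∀ i : ℕ, Integrable (fun x => x ^ i) ρ) :
    ∫ x, p.eval x ∂ρ = ∑ i ∈ Finset.range (p.natDegree + 1), p.coeff i * ∫ x, x ^ i ∂ρ := by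
  simp only [eval_eq_sum_range]
  rw [integral_finsetSum _ fun i _ => (h i).const_mul _]
  simp only [integral_const_mul]

theorem integrable_pow_of_ae_abs_le {P : Measure ℝ} [IsFiniteMeasure P] {R : ℝ}
    (h : ∀ᵐ x ∂P, |x| ≤ R) (i : ℕ) : Integrable (fun x => x ^ i) P := by
  refine Integrable.of_bound (by fun_prop) (R ^ i) ?_
  filter_upwards [h] with x hx
  rw [Real.norm_eq_abs, abs_pow]
  exact pow_le_pow_left₀ (abs_nonneg _) hx i

/-- A bounded continuous function is a polynomial up to `ε` on `[-R, R]` and up to an even monomial,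
of arbitrarily high degree, outside. -/
theorem exists_polynomial_abs_sub_le_add_pow {f : ℝ → ℝ} (hf : Continuous f) {B : ℝ}
    (hB : ∀ x, |f x| ≤ B) {R ε : ℝ} (hR : 0 < R) (hε : 0 < ε) :
    ∃ (p : ℝ[X]) (D : ℝ), 0 ≤ D ∧ ∀ k : ℕ, p.natDegree ≤ 2 * k →
      ∀ x, |f x - p.eval x| ≤ ε + D * (x / R) ^ (2 * k) := by
  obtain ⟨p, hp⟩ := exists_polynomial_near_of_continuousOn (-R) R f hf.continuousOn ε hε
  have hB0 : 0 ≤ B := (abs_nonneg _).trans (hB 0)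
  have hS0 : 0 ≤ ∑ i ∈ Finset.range (p.natDegree + 1), |p.coeff i| * R ^ i :=
    Finset.sum_nonneg fun i _ => by positivity
  refine ⟨p, B + ∑ i ∈ Finset.range (p.natDegree + 1), |p.coeff i| * R ^ i, by positivity,
    fun k hk x => ?_⟩
  have hev : 0 ≤ (x / R) ^ (2 * k) := (even_two_mul k).pow_nonneg _
  rcases le_or_gt |x| R with hx | hx
  · have := hp x (abs_le.1 hx)
    rw [abs_sub_comm] at this
    nlinarith [mul_nonneg (add_nonneg hB0 hS0) hev]
  · have h1 : 1 ≤ |x / R| := by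
      rw [abs_div, abs_of_pos hR, le_div_iff₀ hR]; linarith
    have hpow : ∀ i ≤ 2 * k, |x / R| ^ i ≤ (x / R) ^ (2 * k) := by
      intro i hi
      rw [← (even_two_mul k).pow_abs]
      exact pow_le_pow_right₀ h1 hi
    have hpx : |p.eval x| ≤
        (∑ i ∈ Finset.range (p.natDegree + 1), |p.coeff i| * R ^ i) * (x / R) ^ (2 * k) := by
      rw [eval_eq_sum_range, Finset.sum_mul]
      refine (Finset.abs_sum_le_sum_abs _ _).trans (Finset.sum_le_sum fun i hi => ?_)
      have hxi : |x ^ i| = R ^ i * |x / R| ^ i := by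
        rw [abs_div, abs_of_pos hR, div_pow, abs_pow, mul_div_cancel₀ _ (by positivity)]
      rw [abs_mul, hxi, ← mul_assoc]
      refine mul_le_mul_of_nonneg_left (hpow i ?_) (by positivity)
      have := Finset.mem_range.1 hi
      omega
    have hfx : |f x| ≤ B * (x / R) ^ (2 * k) :=
      (hB x).trans (le_mul_of_one_le_right hB0 (by simpa using hpow 0 (by omega)))
    have := abs_sub (f x) (p.eval x)
    nlinarith

/-- A quantitative method of moments: closeness of finitely many moments to those of a compactly
supported law forces closeness of the integrals of a given bounded continuous function. No tightness
is assumed, since an even moment of high order controls the tails. -/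
theorem exists_moments_close_imp_integral_close {P : Measure ℝ} [IsProbabilityMeasure P] {R₀ : ℝ}
    (hP : ∀ᵐ x ∂P, |x| ≤ R₀) {f : ℝ → ℝ} (hf : Continuous f) {B : ℝ} (hB : ∀ x, |f x| ≤ B)
    {ε : ℝ} (hε : 0 < ε) :
    ∃ (m : ℕ) (δ : ℝ), 0 < δ ∧ ∀ ρ : Measure ℝ, IsProbabilityMeasure ρ →
      (∀ i : ℕ, Integrable (fun x => x ^ i) ρ) →
      (∀ i ≤ m, |∫ x, x ^ i ∂ρ - ∫ x, x ^ i ∂P| ≤ δ) →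
      |∫ x, f x ∂ρ - ∫ x, f x ∂P| ≤ ε := by
  obtain ⟨R, hR₀, hR1⟩ : ∃ R, R₀ < R ∧ 1 ≤ R := ⟨max (R₀ + 1) 1, by simp, by simp⟩
  have hR : 0 < R := by linarith
  have hR00 : 0 ≤ R₀ := by
    obtain ⟨x, hx⟩ := hP.exists
    exact (abs_nonneg _).trans hx
  have hPi := integrable_pow_of_ae_abs_le hP
  obtain ⟨p, D, hD, hp⟩ := exists_polynomial_abs_sub_le_add_pow hf hB hR
    (show 0 < ε / 8 by positivity)
  -- `k` is chosen so large that the tail term is negligible under `P`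
  obtain ⟨k, hk1, hk2⟩ : ∃ k : ℕ, p.natDegree ≤ 2 * k ∧ D * (R₀ / R) ^ (2 * k) ≤ ε / 8 := by
    have ht : Tendsto (fun n : ℕ => D * (R₀ / R) ^ n) atTop (𝓝 (D * 0)) :=
      (tendsto_pow_atTop_nhds_zero_of_lt_one (by positivity)
        ((div_lt_one hR).2 hR₀)).const_mul D
    rw [mul_zero] at ht
    obtain ⟨n, hn⟩ := eventually_atTop.1 (ht.eventually (ge_mem_nhds (show 0 < ε / 8 by positivity)))
    exact ⟨max n p.natDegree, by omega, hn _ (by omega)⟩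
  set S := ∑ i ∈ Finset.range (p.natDegree + 1), |p.coeff i| with hS
  have hS0 : 0 ≤ S := Finset.sum_nonneg fun i _ => abs_nonneg _
  refine ⟨2 * k, ε / (4 * (D + S + 1)), by positivity, fun ρ hρ hρi hm => ?_⟩
  set δ := ε / (4 * (D + S + 1)) with hδ
  have hδ0 : 0 < δ := by positivity
  have hδ' : D * δ + S * δ ≤ ε / 4 := by
    have : (D + S + 1) * δ = ε / 4 := by rw [hδ]; field_simp
    nlinarith
  have hfint : ∀ Q : Measure ℝ, IsProbabilityMeasure Q → Integrable f Q := fun Q _ =>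
    Integrable.of_bound hf.aestronglyMeasurable B (Eventually.of_forall hB)
  have hmom : ∀ Q : Measure ℝ, ∫ x, (x / R) ^ (2 * k) ∂Q = (∫ x, x ^ (2 * k) ∂Q) / R ^ (2 * k) := by
    intro Q
    simp only [div_pow, integral_div]
  have hdiff : ∀ Q : Measure ℝ, IsProbabilityMeasure Q →
      (∀ i : ℕ, Integrable (fun x => x ^ i) Q) →
      |∫ x, f x ∂Q - ∫ x, p.eval x ∂Q| ≤ ε / 8 + D * ((∫ x, x ^ (2 * k) ∂Q) / R ^ (2 * k)) := by
    intro Q hQ hQi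
    have hi : Integrable (fun x => D * (x / R) ^ (2 * k)) Q := by
      simp only [div_pow]
      exact ((hQi _).div_const _).const_mul _
    rw [← integral_sub (hfint Q hQ) (p.integrable_eval hQi)]
    refine (abs_integral_le_integral_abs).trans ?_
    refine (integral_mono ((hfint Q hQ).sub (p.integrable_eval hQi)).abs
      ((integrable_const (ε / 8)).add hi) (hp k hk1)).trans ?_
    simp only [Pi.add_apply]
    rw [integral_add (integrable_const _) hi, integral_const_mul, hmom]
    simp
  have hPk : D * ((∫ x, x ^ (2 * k) ∂P) / R ^ (2 * k)) ≤ ε / 8 := by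
    refine le_trans (mul_le_mul_of_nonneg_left ?_ hD) hk2
    rw [div_pow]
    gcongr
    have := norm_integral_le_of_norm_le_const (μ := P) (f := fun x => x ^ (2 * k))
      (C := R₀ ^ (2 * k)) (by
        filter_upwards [hP] with x hx
        rw [Real.norm_eq_abs, abs_pow]
        exact pow_le_pow_left₀ (abs_nonneg _) hx _)
    exact (le_abs_self _).trans (by simpa using this)
  have hρk : D * ((∫ x, x ^ (2 * k) ∂ρ) / R ^ (2 * k)) ≤ ε / 8 + D * δ := by
    have h1 : ∫ x, x ^ (2 * k) ∂ρ ≤ ∫ x, x ^ (2 * k) ∂P + δ := by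
      linarith [(abs_le.1 (hm (2 * k) le_rfl)).2]
    have h2 : (∫ x, x ^ (2 * k) ∂ρ) / R ^ (2 * k) ≤
        (∫ x, x ^ (2 * k) ∂P) / R ^ (2 * k) + δ := by
      refine (div_le_div_of_nonneg_right h1 (by positivity)).trans ?_
      rw [add_div]
      gcongr
      exact div_le_self hδ0.le (one_le_pow₀ hR1)
    nlinarith [mul_le_mul_of_nonneg_left h2 hD]
  have hpp : |∫ x, p.eval x ∂ρ - ∫ x, p.eval x ∂P| ≤ S * δ := by
    rw [p.integral_eval hρi, p.integral_eval hPi, ← Finset.sum_sub_distrib, hS, Finset.sum_mul]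
    refine (Finset.abs_sum_le_sum_abs _ _).trans (Finset.sum_le_sum fun i hi => ?_)
    rw [← mul_sub, abs_mul]
    refine mul_le_mul_of_nonneg_left (hm i ?_) (abs_nonneg _)
    have := Finset.mem_range.1 hi
    omega
  have d1 := hdiff ρ hρ hρi
  have d2 := hdiff P inferInstance hPi
  rw [abs_le] at d1 d2 hpp ⊢
  constructor <;> linarith [d1.1, d1.2, d2.1, d2.2, hpp.1, hpp.2]

/-! ### Nörlund means -/

namespace IsRegularNorlund

variable {σ τ : ℕ → ℝ}

theorem tau_mul_sum (h : IsRegularNorlund σ τ) (n : ℕ) :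
    τ n * ∑ j ∈ Finset.range (n + 1), σ j = 1 := by
  rw [← h.regular.sum_eq_one n, ← Finset.sum_range_reflect, Finset.mul_sum]
  refine Finset.sum_congr rfl fun k _ => ?_
  rw [norlundWeight, Nat.add_sub_cancel]

theorem tau_pos (h : IsRegularNorlund σ τ) (n : ℕ) : 0 < τ n := by
  refine lt_of_le_of_ne (h.tau_nonneg n) fun h0 => ?_
  have := h.tau_mul_sum n
  simp [← h0] at this

theorem norlundConst_pos (h : IsRegularNorlund σ τ) (n : ℕ) : 0 < norlundConst τ n :=
  mul_pos (h.tau_pos n) (Finset.sum_pos (fun k _ => one_div_pos.2 (h.tau_pos k)) (by simp))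

theorem norlundWeight_nonneg (h : IsRegularNorlund σ τ) (n k : ℕ) : 0 ≤ norlundWeight σ τ n k :=
  mul_nonneg (h.tau_nonneg n) (h.sigma_nonneg _)

/-- The constant `N_n` is the Nörlund mean of the degrees `k + 1`. -/
theorem sum_norlundWeight_mul (h : IsRegularNorlund σ τ) (n : ℕ) :
    ∑ k ∈ Finset.range (n + 1), norlundWeight σ τ n k * (k + 1) = norlundConst τ n := by
  have hinv : ∀ m, 1 / τ m = ∑ j ∈ Finset.range (m + 1), σ j := fun m => by
    rw [div_eq_iff (h.tau_pos m).ne', mul_comm, h.tau_mul_sum]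
  -- passing from `n` to `n + 1` raises each factor `k + 1` by one, adding `σ 0 + ⋯ + σ (n + 1)`
  have hsum : ∀ n : ℕ, ∑ k ∈ Finset.range (n + 1), σ (n - k) * ((k : ℝ) + 1) =
      ∑ m ∈ Finset.range (n + 1), ∑ j ∈ Finset.range (m + 1), σ j := by
    intro n
    induction n with
    | zero => simp
    | succ n ih =>
      rw [Finset.sum_range_succ (fun m => ∑ j ∈ Finset.range (m + 1), σ j), ← ih,
        ← Finset.sum_range_reflect σ, Finset.sum_range_succ' _ (n + 1),
        Finset.sum_range_succ' _ (n + 1), ← add_assoc, ← Finset.sum_add_distrib]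
      congr 1
      · refine Finset.sum_congr rfl fun k _ => ?_
        rw [show n + 1 - (k + 1) = n - k by omega,
          show n + 1 + 1 - 1 - (k + 1) = n - k by omega]
        push_cast
        ring
      · simp
  simp only [norlundWeight, norlundConst, hinv, ← hsum, Finset.mul_sum, mul_assoc]

/-- Nörlund means of quantities that grow like `I` times the degree `k + 1`, uniformly in the
diagonal index. Bounded errors are harmless because `N_n → ∞`. -/
theorem tendsto_mean (h : IsRegularNorlund σ τ) (hlim : Tendsto (norlundConst τ) atTop atTop)
    {F : ℕ → ℕ → ℝ} {I : ℝ}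
    (hF : ∀ ε > 0, ∃ C : ℝ, ∀ j k, |F j k - (k + 1) * I| ≤ ε * (k + 1) + C) :
    Tendsto (fun n => 1 / norlundConst τ n *
      ∑ k ∈ Finset.range (n + 1), norlundWeight σ τ n k * F (n - k) k) atTop (𝓝 I) := by
  rw [Metric.tendsto_atTop]
  intro ε hε
  obtain ⟨C, hC⟩ := hF (ε / 3) (by positivity)
  have ht : Tendsto (fun n => |C| / norlundConst τ n) atTop (𝓝 0) := hlim.const_div_atTop _
  obtain ⟨n₀, hn₀⟩ := eventually_atTop.1 (ht.eventually (gt_mem_nhds (show 0 < ε / 3 by positivity)))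
  refine ⟨n₀, fun n hn => ?_⟩
  have hN := h.norlundConst_pos n
  have hmain : |∑ k ∈ Finset.range (n + 1), norlundWeight σ τ n k * F (n - k) k -
      norlundConst τ n * I| ≤ ε / 3 * norlundConst τ n + |C| := by
    rw [← h.sum_norlundWeight_mul, Finset.sum_mul, ← Finset.sum_sub_distrib]
    refine (Finset.abs_sum_le_sum_abs _ _).trans ?_
    calc ∑ k ∈ Finset.range (n + 1), |norlundWeight σ τ n k * F (n - k) k -
          norlundWeight σ τ n k * (k + 1) * I|
        ≤ ∑ k ∈ Finset.range (n + 1),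
          (ε / 3 * (norlundWeight σ τ n k * (k + 1)) + norlundWeight σ τ n k * |C|) := by
          refine Finset.sum_le_sum fun k _ => ?_
          rw [mul_assoc, ← mul_sub, abs_mul, abs_of_nonneg (h.norlundWeight_nonneg n k)]
          have := mul_le_mul_of_nonneg_left ((hC (n - k) k).trans
            (add_le_add_right (le_abs_self C) _)) (h.norlundWeight_nonneg n k)
          linarith
      _ = _ := by
          rw [Finset.sum_add_distrib, ← Finset.mul_sum, ← Finset.sum_mul,
            h.regular.sum_eq_one n, one_mul]
  rw [Real.dist_eq]
  have e : 1 / norlundConst τ n * ∑ k ∈ Finset.range (n + 1), norlundWeight σ τ n k * F (n - k) k -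
      I = (∑ k ∈ Finset.range (n + 1), norlundWeight σ τ n k * F (n - k) k -
      norlundConst τ n * I) / norlundConst τ n := by
    field_simp
  rw [e, abs_div, abs_of_pos hN]
  calc _ ≤ (ε / 3 * norlundConst τ n + |C|) / norlundConst τ n :=
        div_le_div_of_nonneg_right hmain hN.le
    _ = ε / 3 + |C| / norlundConst τ n := by field_simp
    _ < ε := by linarith [hn₀ n hn]

end IsRegularNorlund

/-! ### The uniform Nevai condition -/

theorem eventually_forall_abs_le_of_tendsto_iSup {u : ℕ → ℕ → ℝ}
    (h : Tendsto (fun n => ⨆ k, ‖u k n‖ₑ) atTop (𝓝 0)) {δ : ℝ} (hδ : 0 < δ) :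
    ∀ᶠ n in atTop, ∀ k, |u k n| ≤ δ := by
  filter_upwards [h.eventually (ge_mem_nhds (show (0 : ℝ≥0∞) < ENNReal.ofReal δ by simpa))]
    with n hn k
  have := (le_iSup (fun k => ‖u k n‖ₑ) k).trans hn
  rwa [← ofReal_norm, ENNReal.ofReal_le_ofReal_iff hδ.le] at this

/-- Under the uniform Nevai condition a probability measure whose moments are the diagonal entries
at `l` of the powers of a matrix coinciding near `l` with the Jacobi matrix of some `μ k` is weakly
close to the arcsine distribution, uniformly in `k`, as soon as `l` is large. -/
theorem UniformNevai.exists_integral_close {μ : ℕ → Measure ℝ} {a b : ℝ} (hN : UniformNevai μ a b)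
    (hb : 0 < b) {f : ℝ → ℝ} (hf : Continuous f) {B : ℝ} (hB : ∀ x, |f x| ≤ B)
    {ε : ℝ} (hε : 0 < ε) :
    ∃ L r : ℕ, ∀ k l, L ≤ l → ∀ ρ : Measure ℝ, IsProbabilityMeasure ρ →
      (∀ i : ℕ, Integrable (fun x => x ^ i) ρ) → ∀ T : ℕ → ℕ → ℝ,
      (∀ i, l ≤ i + r → i ≤ l + r → T 0 i = if i = l then 1 else 0) →
      (∀ n i, l < i + r → i < l + r → T (n + 1) i = recurrenceB (μ k) (i + 1) * T n (i + 1) +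
        recurrenceA (μ k) i * T n i + recurrenceB (μ k) i * T n (i - 1)) →
      (∀ m, ∫ x, x ^ m ∂ρ = T m l) →
      |∫ x, f x ∂ρ - ∫ x, f x ∂(arcsineMeasure a b)| ≤ ε := by
  have := isProbabilityMeasure_arcsineMeasure (a := a) hb
  obtain ⟨m, δ, hδ, hm⟩ := exists_moments_close_imp_integral_close
    (ae_abs_le_arcsineMeasure (a := a) hb) hf hB hε
  choose C hC0 hC using exists_abs_sub_arcsineMoment_le a hb
  set S := ∑ i ∈ Finset.range (m + 1), C i with hS
  have hS0 : 0 ≤ S := Finset.sum_nonneg fun i _ => hC0 i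
  set η := min 1 (δ / (S + 1)) with hη
  have hη0 : 0 < η := lt_min one_pos (by positivity)
  have hSη : S * η ≤ δ := by
    have h1 : η ≤ δ / (S + 1) := min_le_right _ _
    rw [le_div_iff₀ (by positivity)] at h1
    nlinarith
  obtain ⟨L, hL⟩ := eventually_atTop.1
    ((eventually_forall_abs_le_of_tendsto_iSup hN.1 hη0).and
      (eventually_forall_abs_le_of_tendsto_iSup hN.2 hη0))
  refine ⟨L + m + 1, m, fun k l hl ρ hρ hρi T hT0 hTs hρT => hm ρ hρ hρi fun i hi => ?_⟩
  have h1 := hC i (recurrenceA (μ k)) (recurrenceB (μ k)) η l m T (min_le_left _ _) (by omega)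
    (fun j hj => ⟨(hL j (by omega)).1 k, (hL j (by omega)).2 k⟩) hT0 hTs l (by omega) (by omega)
  rw [sub_self, arcsineMoment_zero_right hb, ← hρT] at h1
  refine h1.trans (le_trans ?_ hSη)
  exact mul_le_mul_of_nonneg_right (Finset.single_le_sum (fun j _ => hC0 j)
    (Finset.mem_range.2 (by omega))) hη0.le

/-- A sum of `n` bounded terms that are small except near the two ends of the range. -/
theorem abs_sum_range_le_of_abs_le {s : ℕ → ℝ} {n L r : ℕ} {ε D : ℝ} (hε : 0 ≤ ε)
    (hD : ∀ l < n, |s l| ≤ D) (hs : ∀ l, L ≤ l → l + r < n → |s l| ≤ ε) (hD0 : 0 ≤ D) :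
    |∑ l ∈ Finset.range n, s l| ≤ ε * n + D * (L + r) := by
  have hterm : ∀ l ∈ Finset.range n,
      |s l| ≤ ε + ((if l < L then D else 0) + (if n ≤ l + r then D else 0)) := by
    intro l hl
    have hl' := hD l (Finset.mem_range.1 hl)
    by_cases h1 : l < L
    · rw [if_pos h1]; split_ifs <;> linarith
    · by_cases h2 : n ≤ l + r
      · rw [if_pos h2, if_neg h1]; linarith
      · rw [if_neg h1, if_neg h2]; linarith [hs l (by omega) (by omega)]
  refine (Finset.abs_sum_le_sum_abs _ _).trans ((Finset.sum_le_sum hterm).trans ?_)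
  rw [Finset.sum_add_distrib, Finset.sum_add_distrib, Finset.sum_const, Finset.card_range,
    nsmul_eq_mul, ← Finset.sum_filter, ← Finset.sum_filter, Finset.sum_const, Finset.sum_const,
    nsmul_eq_mul, nsmul_eq_mul]
  have c1 : ((Finset.range n).filter (· < L)).card ≤ L := by
    refine (Finset.card_le_card (t := Finset.range L) fun x hx => ?_).trans (by simp)
    simp only [Finset.mem_filter, Finset.mem_range] at hx ⊢
    exact hx.2
  have c2 : ((Finset.range n).filter (n ≤ · + r)).card ≤ r := by
    refine (Finset.card_le_card (t := Finset.Ico (n - r) n) fun x hx => ?_).trans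
      (by rw [Nat.card_Ico]; omega)
    simp only [Finset.mem_filter, Finset.mem_range, Finset.mem_Ico] at hx ⊢
    omega
  have c1' : ((((Finset.range n).filter (· < L)).card : ℕ) : ℝ) ≤ L := by exact_mod_cast c1
  have c2' : ((((Finset.range n).filter (n ≤ · + r)).card : ℕ) : ℝ) ≤ r := by exact_mod_cast c2
  nlinarith [mul_le_mul_of_nonneg_right c1' hD0, mul_le_mul_of_nonneg_right c2' hD0]

theorem abs_integral_sub_integral_le {ρ P : Measure ℝ} [IsProbabilityMeasure ρ]
    [IsProbabilityMeasure P] {f : ℝ → ℝ} {B : ℝ} (hB : ∀ x, |f x| ≤ B) :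
    |∫ x, f x ∂ρ - ∫ x, f x ∂P| ≤ 2 * B := by
  have h1 := norm_integral_le_of_norm_le_const (μ := ρ) (f := f) (Eventually.of_forall hB)
  have h2 := norm_integral_le_of_norm_le_const (μ := P) (f := f) (Eventually.of_forall hB)
  simp only [Real.norm_eq_abs, probReal_univ, mul_one] at h1 h2
  exact (abs_sub _ _).trans (by linarith)

/-! ### The measures `p_l² dμ` -/

/-- The entry `⟨p_i, x^m p_l⟩` of the `m`-th power of the Jacobi matrix of `μ`. -/
noncomputable def jacobiPow (μ : Measure ℝ) (l m i : ℕ) : ℝ :=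
  ∫ x, x ^ m * ((orthoPoly μ i).eval x * (orthoPoly μ l).eval x) ∂μ

theorem IsAdmissible.recurrence_eval {μ : Measure ℝ} (h : IsAdmissible μ) (n : ℕ) (x : ℝ) :
    x * (orthoPoly μ n).eval x = recurrenceB μ (n + 1) * (orthoPoly μ (n + 1)).eval x +
      recurrenceA μ n * (orthoPoly μ n).eval x +
      recurrenceB μ n * (orthoPoly μ (n - 1)).eval x := by
  have := congrArg (Polynomial.eval x) (h.three_term_recurrence n)
  simpa using this

theorem IsAdmissible.jacobiPow_succ {μ : Measure ℝ} (h : IsAdmissible μ) (l m i : ℕ) :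
    jacobiPow μ l (m + 1) i = recurrenceB μ (i + 1) * jacobiPow μ l m (i + 1) +
      recurrenceA μ i * jacobiPow μ l m i + recurrenceB μ i * jacobiPow μ l m (i - 1) := by
  have hI : ∀ (c : ℝ) (e : ℕ), Integrable
      (fun x => c * (x ^ m * ((orthoPoly μ e).eval x * (orthoPoly μ l).eval x))) μ :=
    fun c e => h.integrable_continuous (by fun_prop)
  simp only [jacobiPow]
  rw [← integral_const_mul, ← integral_const_mul, ← integral_const_mul,
    ← integral_add (hI _ _) (hI _ _)]
  have := integral_add ((hI (recurrenceB μ (i + 1)) (i + 1)).add (hI (recurrenceA μ i) i))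
    (hI (recurrenceB μ i) (i - 1))
  simp only [Pi.add_apply] at this
  rw [← this]
  refine integral_congr_ae (Eventually.of_forall fun x => ?_)
  have := h.recurrence_eval i x
  linear_combination (x ^ m * (orthoPoly μ l).eval x) * this

theorem IsAdmissible.jacobiPow_zero {μ : Measure ℝ} (h : IsAdmissible μ) (l i : ℕ) :
    jacobiPow μ l 0 i = if i = l then 1 else 0 := by
  simp only [jacobiPow, pow_zero, one_mul]
  exact h.orthoPoly_orthonormal i l

/-- The probability measure `p_l² dμ`. -/
noncomputable def orthoDensity (μ : Measure ℝ) (l : ℕ) : Measure ℝ :=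
  μ.withDensity fun x => ENNReal.ofReal ((orthoPoly μ l).eval x ^ 2)

theorem integral_orthoDensity (μ : Measure ℝ) (l : ℕ) (g : ℝ → ℝ) :
    ∫ x, g x ∂(orthoDensity μ l) = ∫ x, (orthoPoly μ l).eval x ^ 2 * g x ∂μ := by
  rw [orthoDensity, integral_withDensity_eq_integral_toReal_smul (by fun_prop)
    (Eventually.of_forall fun x => ENNReal.ofReal_lt_top)]
  simp only [ENNReal.toReal_ofReal (sq_nonneg _), smul_eq_mul]

theorem IsAdmissible.integrable_orthoDensity {μ : Measure ℝ} (h : IsAdmissible μ) (l : ℕ)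
    {g : ℝ → ℝ} (hg : Continuous g) : Integrable g (orthoDensity μ l) := by
  rw [orthoDensity, integrable_withDensity_iff_integrable_smul' (by fun_prop)
    (Eventually.of_forall fun x => ENNReal.ofReal_lt_top)]
  simp only [ENNReal.toReal_ofReal (sq_nonneg _), smul_eq_mul]
  exact h.integrable_continuous (by fun_prop)

theorem IsAdmissible.isProbabilityMeasure_orthoDensity {μ : Measure ℝ} (h : IsAdmissible μ)
    (l : ℕ) : IsProbabilityMeasure (orthoDensity μ l) := by
  constructor
  rw [orthoDensity, withDensity_apply _ MeasurableSet.univ, Measure.restrict_univ,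
    ← ofReal_integral_eq_lintegral_ofReal (h.integrable_continuous (by fun_prop))
      (Eventually.of_forall fun x => sq_nonneg _)]
  have := h.orthoPoly_orthonormal l l
  simp only [← sq, if_true] at this
  rw [this, ENNReal.ofReal_one]

theorem integral_pow_orthoDensity (μ : Measure ℝ) (l m : ℕ) :
    ∫ x, x ^ m ∂(orthoDensity μ l) = jacobiPow μ l m l := by
  rw [integral_orthoDensity, jacobiPow]
  congr 1
  ext x
  ring

/-- `K_k(x, x) dμ` is the sum of the measures `p_l² dμ`, `l ≤ k`. -/
theorem withDensity_cdKernel (μ : Measure ℝ) (k : ℕ) :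
    μ.withDensity (fun x => ENNReal.ofReal (cdKernel μ k x x)) =
      ∑ l ∈ Finset.range (k + 1), orthoDensity μ l := by
  ext s hs
  rw [withDensity_apply _ hs, Measure.finsetSum_apply]
  simp only [orthoDensity, withDensity_apply _ hs]
  rw [← lintegral_finsetSum _ (fun l _ => by fun_prop)]
  refine lintegral_congr fun x => ?_
  rw [cdKernel, ENNReal.ofReal_sum_of_nonneg fun l _ => mul_self_nonneg _]
  simp only [sq]

theorem UniformNevai.exists_abs_sum_orthoDensity_sub_le {μ : ℕ → Measure ℝ} {a b : ℝ}
    (hμ : ∀ k, IsAdmissible (μ k)) (hN : UniformNevai μ a b) (hb : 0 < b) {f : ℝ → ℝ}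
    (hf : Continuous f) {B : ℝ} (hB : ∀ x, |f x| ≤ B) {ε : ℝ} (hε : 0 < ε) :
    ∃ C : ℝ, ∀ j k : ℕ, |∑ l ∈ Finset.range (k + 1), ∫ x, f x ∂(orthoDensity (μ j) l) -
      (k + 1) * ∫ x, f x ∂(arcsineMeasure a b)| ≤ ε * (k + 1) + C := by
  obtain ⟨L, r, h⟩ := hN.exists_integral_close hb hf hB hε
  have := isProbabilityMeasure_arcsineMeasure (a := a) hb
  have hB0 : 0 ≤ B := (abs_nonneg _).trans (hB 0)
  refine ⟨2 * B * (L + (0 : ℕ)), fun j k => ?_⟩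
  have hprob := fun l => (hμ j).isProbabilityMeasure_orthoDensity l
  have := abs_sum_range_le_of_abs_le (n := k + 1) (L := L) (r := 0) (D := 2 * B)
    (s := fun l => ∫ x, f x ∂(orthoDensity (μ j) l) - ∫ x, f x ∂(arcsineMeasure a b)) hε.le
    (fun l _ => abs_integral_sub_integral_le hB)
    (fun l hl _ => h j l hl _ (hprob l)
      (fun i => (hμ j).integrable_orthoDensity l (by fun_prop)) (jacobiPow (μ j) l)
      (fun i _ _ => (hμ j).jacobiPow_zero l i) (fun n i _ _ => (hμ j).jacobiPow_succ l n i)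
      (fun m => integral_pow_orthoDensity (μ j) l m)) (by positivity)
  rw [Finset.sum_sub_distrib, Finset.sum_const, Finset.card_range, nsmul_eq_mul] at this
  exact_mod_cast this

/-! ### Truncated Jacobi matrices and the zeros of orthogonal polynomials -/

/-- The `n × n` Jacobi matrix with diagonal `α 0, …, α (n-1)` and off-diagonal
`β 1, …, β (n-1)`. -/
def jacobiMatrix (α β : ℕ → ℝ) (n : ℕ) : Matrix (Fin n) (Fin n) ℝ :=
  Matrix.of fun i k => (if (k : ℕ) = i + 1 then β (i + 1) else 0) +
    (if (k : ℕ) = i then α i else 0) + (if (k : ℕ) + 1 = i then β i else 0)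

theorem isHermitian_jacobiMatrix (α β : ℕ → ℝ) (n : ℕ) : (jacobiMatrix α β n).IsHermitian := by
  have hβ : ∀ p q : ℕ, (if q = p + 1 then β (p + 1) else 0) = if p + 1 = q then β q else 0 := by
    intro p q
    by_cases h : q = p + 1
    · simp [h]
    · rw [if_neg h, if_neg (Ne.symm h)]
  have hα : ∀ p q : ℕ, (if q = p then α p else 0) = if p = q then α q else 0 := by
    intro p q
    by_cases h : q = p
    · simp [h]
    · rw [if_neg h, if_neg (Ne.symm h)]
  ext i k
  simp only [jacobiMatrix, Matrix.conjTranspose_apply, Matrix.of_apply, star_trivial]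
  rw [hβ i k, ← hβ k i, hα i k]
  ring

/-- Spectral decomposition of a truncated Jacobi matrix. The eigenvectors `v j` are extended to
`ℕ` by zero, so that the eigenvalue equation takes the form of the three-term recurrence. -/
theorem exists_jacobi_eigenvectors (α β : ℕ → ℝ) (hβ : β 0 = 0) (n : ℕ) :
    ∃ (θ : Fin n → ℝ) (v : Fin n → ℕ → ℝ),
      (∀ j i, i < n → θ j * v j i = β (i + 1) * v j (i + 1) + α i * v j i + β i * v j (i - 1)) ∧
      (∀ j i, n ≤ i → v j i = 0) ∧
      (∀ i < n, ∀ l < n, ∑ j, v j i * v j l = if i = l then 1 else 0) ∧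
      (∀ j j', ∑ i ∈ Finset.range n, v j i * v j' i = if j = j' then 1 else 0) := by
  have hJ := isHermitian_jacobiMatrix α β n
  set e := hJ.eigenvectorBasis with he
  have hv : ∀ j (i : Fin n), (if h : (i : ℕ) < n then e j ⟨i, h⟩ else 0) = e j i := fun j i => by
    simp
  refine ⟨hJ.eigenvalues, fun j i => if h : i < n then e j ⟨i, h⟩ else 0, ?_, ?_, ?_, ?_⟩
  · intro j i hi
    have h1 : ∑ k, jacobiMatrix α β n ⟨i, hi⟩ k * e j k = hJ.eigenvalues j * e j ⟨i, hi⟩ :=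
      congrFun (hJ.mulVec_eigenvectorBasis j) ⟨i, hi⟩
    have h2 : ∀ k, jacobiMatrix α β n ⟨i, hi⟩ k = (if (k : ℕ) = i + 1 then β (i + 1) else 0) +
      (if (k : ℕ) = i then α i else 0) + (if (k : ℕ) + 1 = i then β i else 0) := fun _ => rfl
    have h3 := Fin.sum_univ_eq_sum_range (fun k => ((if k = i + 1 then β (i + 1) else 0) +
      (if k = i then α i else 0) + (if k + 1 = i then β i else 0)) *
      (if h : k < n then e j ⟨k, h⟩ else 0)) n
    simp only [hv, ← h2] at h3
    have h4 : hJ.eigenvalues j * (if h : i < n then e j ⟨i, h⟩ else 0) =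
        hJ.eigenvalues j * e j ⟨i, hi⟩ := by rw [dif_pos hi]
    refine h4.trans ((h1.symm.trans h3).trans ?_)
    simp only [add_mul, Finset.sum_add_distrib, ite_mul, zero_mul, Finset.sum_ite_eq',
      Finset.mem_range]
    congr 1
    · congr 1
      · split_ifs with h
        · rfl
        · simp
      · rw [if_pos hi]
    · rcases i with _ | i
      · simp [hβ]
      · simp only [Nat.add_right_cancel_iff, Finset.sum_ite_eq', Finset.mem_range,
          Nat.add_sub_cancel]
        rw [if_pos (by omega)]
  · intro j i hi
    exact dif_neg (by omega)
  · intro i hi l hl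
    simp only [dif_pos hi, dif_pos hl]
    have := (hJ.eigenvectorUnitary).2
    rw [Matrix.mem_unitaryGroup_iff] at this
    have := congrFun (congrFun this ⟨i, hi⟩) ⟨l, hl⟩
    simpa [Matrix.mul_apply, Matrix.one_apply, Matrix.star_apply] using this
  · intro j j'
    have := (orthonormal_iff_ite.1 e.orthonormal) j' j
    rw [PiLp.inner_apply] at this
    simp only [eq_comm (a := j)]
    rw [← this, ← Fin.sum_univ_eq_sum_range (fun i => (if h : i < n then e j ⟨i, h⟩ else 0) *
      (if h : i < n then e j' ⟨i, h⟩ else 0)) n]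
    simp only [hv]
    simp

theorem IsAdmissible.recurrenceB_succ_pos {μ : Measure ℝ} (h : IsAdmissible μ) (n : ℕ) :
    0 < recurrenceB μ (n + 1) := by
  have hcoef : ∀ m, (orthoPoly μ m).coeff m = (orthoPoly μ m).leadingCoeff := fun m => by
    rw [leadingCoeff, natDegree_eq_of_degree_eq_some (h.orthoPoly_degree m).1]
  have hz : ∀ i l, i < l → (orthoPoly μ i).coeff l = 0 := fun i l hil =>
    coeff_eq_zero_of_degree_lt (by rw [(h.orthoPoly_degree i).1]; exact_mod_cast hil)
  have := congrArg (fun p => coeff p (n + 1)) (h.three_term_recurrence n)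
  simp only [coeff_add, coeff_C_mul, coeff_X_mul] at this
  rw [hz n (n + 1) (by omega), hz (n - 1) (n + 1) (by omega), hcoef, hcoef, mul_zero, mul_zero,
    add_zero, add_zero] at this
  have h1 := (h.orthoPoly_degree n).2
  rw [this] at h1
  exact pos_of_mul_pos_left h1 (h.orthoPoly_degree (n + 1)).2.le

theorem IsAdmissible.orthoPoly_ne_zero {μ : Measure ℝ} (h : IsAdmissible μ) (n : ℕ) :
    orthoPoly μ n ≠ 0 := leadingCoeff_ne_zero.1 (h.orthoPoly_degree n).2.ne'

theorem IsAdmissible.eval_orthoPoly_zero {μ : Measure ℝ} (h : IsAdmissible μ) :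
    ∃ c : ℝ, c ≠ 0 ∧ ∀ x, (orthoPoly μ 0).eval x = c := by
  obtain ⟨hd, hl⟩ := h.orthoPoly_degree 0
  have := eq_C_of_degree_eq_zero (p := orthoPoly μ 0) (by simpa using hd)
  refine ⟨(orthoPoly μ 0).coeff 0, fun h0 => ?_, fun x => ?_⟩
  · rw [h0, C_0] at this
    exact h.orthoPoly_ne_zero 0 this
  · rw [this]; simp

/-- The zeros of `p_n` are the `n` distinct eigenvalues of the truncated Jacobi matrix: an
eigenvector is a multiple of `(p_0(θ), …, p_{n-1}(θ))`, so it is determined by its eigenvalue. -/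
theorem IsAdmissible.exists_eigenvectors_roots {μ : Measure ℝ} (h : IsAdmissible μ) (n : ℕ) :
    ∃ (θ : Fin n → ℝ) (v : Fin n → ℕ → ℝ),
      (∀ j i, i < n → θ j * v j i = recurrenceB μ (i + 1) * v j (i + 1) +
        recurrenceA μ i * v j i + recurrenceB μ i * v j (i - 1)) ∧
      (∀ i < n, ∀ l < n, ∑ j, v j i * v j l = if i = l then 1 else 0) ∧
      (∀ j, ∑ i ∈ Finset.range n, v j i ^ 2 = 1) ∧
      Function.Injective θ ∧ (orthoPoly μ n).roots.toFinset = Finset.univ.image θ := by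
  obtain ⟨θ, v, hrec, hout, hcol, hrow⟩ :=
    exists_jacobi_eigenvectors (recurrenceA μ) (recurrenceB μ) rfl n
  obtain ⟨c₀, hc₀, hp0⟩ := h.eval_orthoPoly_zero
  -- the index `i = n` is included, where `v j n = 0` by the choice of the extension
  have hmul : ∀ j i, i ≤ n → v j i = v j 0 / c₀ * (orthoPoly μ i).eval (θ j) := by
    intro j i
    induction i using Nat.strong_induction_on with
    | _ i ih =>
      intro hi
      rcases i with _ | i
      · rw [hp0, div_mul_cancel₀ _ hc₀]
      · have e1 := hrec j i (by omega)
        have e2 := h.recurrence_eval i (θ j)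
        rw [ih i (by omega) (by omega), ih (i - 1) (by omega) (by omega)] at e1
        refine mul_left_cancel₀ (h.recurrenceB_succ_pos i).ne' ?_
        linear_combination -e1 + v j 0 / c₀ * e2
  have hrow1 : ∀ j, ∑ i ∈ Finset.range n, v j i ^ 2 = 1 := fun j => by
    simpa [sq] using hrow j j
  have hne : ∀ j, v j 0 / c₀ ≠ 0 := by
    intro j h0
    have : ∑ i ∈ Finset.range n, v j i ^ 2 = 0 := Finset.sum_eq_zero fun i hi => by
      rw [hmul j i (Finset.mem_range.1 hi).le, h0]; ring
    rw [hrow1] at this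
    exact one_ne_zero this
  have hroot : ∀ j, (orthoPoly μ n).eval (θ j) = 0 := fun j => by
    have := hmul j n le_rfl
    rw [hout j n le_rfl] at this
    exact (mul_eq_zero.1 this.symm).resolve_left (hne j)
  have hinj : Function.Injective θ := by
    intro j j' hjj
    by_contra hcon
    have h1 := hrow j j'
    rw [if_neg hcon] at h1
    have h2 : ∀ i ∈ Finset.range n, v j i * v j' i =
        (v j' 0 / c₀) / (v j 0 / c₀) * v j i ^ 2 := by
      intro i hi
      have hi' := (Finset.mem_range.1 hi).le
      rw [hmul j i hi', hmul j' i hi', ← hjj]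
      have := hne j
      field_simp
    rw [Finset.sum_congr rfl h2, ← Finset.mul_sum, hrow1, mul_one] at h1
    exact div_ne_zero (hne j') (hne j) h1
  refine ⟨θ, v, hrec, hcol, hrow1, hinj, (Finset.eq_of_subset_of_card_le ?_ ?_).symm⟩
  · intro x hx
    obtain ⟨j, -, rfl⟩ := Finset.mem_image.1 hx
    rw [Multiset.mem_toFinset, mem_roots (h.orthoPoly_ne_zero n)]
    exact hroot j
  · rw [Finset.card_image_of_injective _ hinj, Finset.card_univ, Fintype.card_fin]
    refine (Multiset.toFinset_card_le _).trans ((card_roots' _).trans ?_)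
    rw [natDegree_eq_of_degree_eq_some (h.orthoPoly_degree n).1]

theorem IsAdmissible.card_roots_toFinset {μ : Measure ℝ} (h : IsAdmissible μ) (n : ℕ) :
    (orthoPoly μ n).roots.toFinset.card = n := by
  obtain ⟨θ, v, -, -, -, hinj, hroots⟩ := h.exists_eigenvectors_roots n
  rw [hroots, Finset.card_image_of_injective _ hinj, Finset.card_univ, Fintype.card_fin]

/-- The finitely supported measure with mass `w j` at `θ j`. -/
noncomputable def atomicMeasure {n : ℕ} (θ w : Fin n → ℝ) : Measure ℝ :=
  ∑ j, ENNReal.ofReal (w j) • Measure.dirac (θ j)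

theorem integrable_atomicMeasure {n : ℕ} (θ w : Fin n → ℝ) (g : ℝ → ℝ) :
    Integrable g (atomicMeasure θ w) := by
  refine integrable_finsetSum_measure.2 fun j _ => Integrable.smul_measure ?_ (by simp)
  exact integrable_dirac (by simp)

theorem integral_atomicMeasure {n : ℕ} {θ w : Fin n → ℝ} (hw : ∀ j, 0 ≤ w j) (g : ℝ → ℝ) :
    ∫ x, g x ∂(atomicMeasure θ w) = ∑ j, w j * g (θ j) := by
  rw [atomicMeasure, integral_finsetSum_measure fun j _ =>
    (integrable_dirac (by simp)).smul_measure (by simp)]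
  refine Finset.sum_congr rfl fun j _ => ?_
  rw [integral_smul_measure, integral_dirac, ENNReal.toReal_ofReal (hw j), smul_eq_mul]

theorem isProbabilityMeasure_atomicMeasure {n : ℕ} {θ w : Fin n → ℝ} (hw : ∀ j, 0 ≤ w j)
    (hs : ∑ j, w j = 1) : IsProbabilityMeasure (atomicMeasure θ w) := by
  constructor
  rw [atomicMeasure, Measure.finsetSum_apply]
  simp only [Measure.smul_apply, measure_univ, smul_eq_mul, mul_one]
  rw [← ENNReal.ofReal_sum_of_nonneg fun j _ => hw j, hs, ENNReal.ofReal_one]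

/-- The sum over the zeros of `p_{k+1}` splits as `∑_l ∫ f dρ_l`, where `ρ_l` is the spectral measure
of the truncated Jacobi matrix at the `l`-th unit vector. Away from the two ends of the matrix,
`ρ_l` has the same low moments as `p_l² dμ`. -/
theorem UniformNevai.exists_abs_sum_roots_sub_le {μ : ℕ → Measure ℝ} {a b : ℝ}
    (hμ : ∀ k, IsAdmissible (μ k)) (hN : UniformNevai μ a b) (hb : 0 < b) {f : ℝ → ℝ}
    (hf : Continuous f) {B : ℝ} (hB : ∀ x, |f x| ≤ B) {ε : ℝ} (hε : 0 < ε) :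
    ∃ C : ℝ, ∀ j k : ℕ, |∑ x ∈ (orthoPoly (μ j) (k + 1)).roots.toFinset, f x -
      (k + 1) * ∫ x, f x ∂(arcsineMeasure a b)| ≤ ε * (k + 1) + C := by
  obtain ⟨L, r, h⟩ := hN.exists_integral_close hb hf hB hε
  have := isProbabilityMeasure_arcsineMeasure (a := a) hb
  have hB0 : 0 ≤ B := (abs_nonneg _).trans (hB 0)
  refine ⟨2 * B * (L + r), fun j k => ?_⟩
  obtain ⟨θ, v, hrec, hcol, hrow, hinj, hroots⟩ := (hμ j).exists_eigenvectors_roots (k + 1)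
  set ρ : ℕ → Measure ℝ := fun l => atomicMeasure θ fun i => v i l ^ 2 with hρ
  have hint : ∀ l (g : ℝ → ℝ), ∫ x, g x ∂(ρ l) = ∑ i, v i l ^ 2 * g (θ i) := fun l g =>
    integral_atomicMeasure (fun i => sq_nonneg _) g
  have hprob : ∀ l < k + 1, IsProbabilityMeasure (ρ l) := fun l hl =>
    isProbabilityMeasure_atomicMeasure (fun i => sq_nonneg _) (by
      simpa [sq] using hcol l hl l hl)
  have hsum : ∑ x ∈ (orthoPoly (μ j) (k + 1)).roots.toFinset, f x =
      ∑ l ∈ Finset.range (k + 1), ∫ x, f x ∂(ρ l) := by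
    simp only [hint]
    rw [hroots, Finset.sum_image fun _ _ _ _ h => hinj h, Finset.sum_comm]
    refine Finset.sum_congr rfl fun i _ => ?_
    rw [← Finset.sum_mul, hrow, one_mul]
  have hclose : ∀ l, L ≤ l → l + r < k + 1 →
      |∫ x, f x ∂(ρ l) - ∫ x, f x ∂(arcsineMeasure a b)| ≤ ε := by
    intro l hl hlr
    refine h j l hl _ (hprob l (by omega)) (fun i => integrable_atomicMeasure _ _ _)
      (fun m i => ∑ q, θ q ^ m * (v q i * v q l)) ?_ ?_ ?_
    · intro i _ hi
      simp only [pow_zero, one_mul]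
      exact hcol i (by omega) l (by omega)
    · intro n i _ hi
      simp only [Finset.mul_sum, ← Finset.sum_add_distrib]
      refine Finset.sum_congr rfl fun q _ => ?_
      linear_combination (θ q ^ n * v q l) * hrec q i (by omega)
    · intro m
      rw [hint]
      exact Finset.sum_congr rfl fun q _ => by ring
  have := abs_sum_range_le_of_abs_le (n := k + 1) (L := L) (r := r) (D := 2 * B)
    (s := fun l => ∫ x, f x ∂(ρ l) - ∫ x, f x ∂(arcsineMeasure a b)) hε.le
    (fun l hl => by
      have := hprob l hl
      exact abs_integral_sub_integral_le hB) hclose (by positivity)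
  rw [Finset.sum_sub_distrib, Finset.sum_const, Finset.card_range, nsmul_eq_mul, ← hsum] at this
  exact_mod_cast this

/-! ### Nörlund means of measures -/

/-- The normalized Nörlund mean `N_n⁻¹ ∑_{k ≤ n} σ_{n,k} Q (n - k) k` of a doubly indexed family of
measures. -/
noncomputable def norlundMean (σ τ : ℕ → ℝ) (Q : ℕ → ℕ → Measure ℝ) (n : ℕ) : Measure ℝ :=
  ENNReal.ofReal (1 / norlundConst τ n) •
    ∑ k ∈ Finset.range (n + 1), ENNReal.ofReal (norlundWeight σ τ n k) • Q (n - k) k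

namespace IsRegularNorlund

variable {σ τ : ℕ → ℝ} {Q : ℕ → ℕ → Measure ℝ}

theorem isProbabilityMeasure_norlundMean (h : IsRegularNorlund σ τ)
    (hQ : ∀ j k : ℕ, Q j k Set.univ = ENNReal.ofReal (k + 1)) (n : ℕ) :
    IsProbabilityMeasure (norlundMean σ τ Q n) := by
  constructor
  rw [norlundMean, Measure.smul_apply, Measure.finsetSum_apply, smul_eq_mul]
  simp only [Measure.smul_apply, hQ, smul_eq_mul]
  simp only [← ENNReal.ofReal_mul (h.norlundWeight_nonneg n _)]
  rw [← ENNReal.ofReal_sum_of_nonneg fun k _ =>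
      mul_nonneg (h.norlundWeight_nonneg n k) (by positivity), h.sum_norlundWeight_mul,
    ← ENNReal.ofReal_mul (one_div_nonneg.2 (h.norlundConst_pos n).le),
    one_div_mul_cancel (h.norlundConst_pos n).ne', ENNReal.ofReal_one]

theorem integral_norlundMean (h : IsRegularNorlund σ τ) {f : ℝ → ℝ}
    (hf : ∀ j k, Integrable f (Q j k)) (n : ℕ) :
    ∫ x, f x ∂(norlundMean σ τ Q n) = 1 / norlundConst τ n *
      ∑ k ∈ Finset.range (n + 1), norlundWeight σ τ n k * ∫ x, f x ∂(Q (n - k) k) := by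
  rw [norlundMean, integral_smul_measure, integral_finsetSum_measure fun k _ =>
    (hf _ _).smul_measure (by simp), smul_eq_mul,
    ENNReal.toReal_ofReal (one_div_nonneg.2 (h.norlundConst_pos n).le)]
  congr 1
  refine Finset.sum_congr rfl fun k _ => ?_
  rw [integral_smul_measure, ENNReal.toReal_ofReal (h.norlundWeight_nonneg n k), smul_eq_mul]

theorem ae_norlundMean {p : ℝ → Prop} (hp : ∀ j k, ∀ᵐ x ∂(Q j k), p x) (n : ℕ) :
    ∀ᵐ x ∂(norlundMean σ τ Q n), p x := by
  refine Measure.ae_smul_measure ?_ _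
  rw [ae_iff, Measure.finsetSum_apply]
  refine Finset.sum_eq_zero fun k _ => ?_
  rw [Measure.smul_apply, ae_iff.1 (hp _ _), smul_zero]

theorem convergesWeakly_norlundMean (h : IsRegularNorlund σ τ)
    (hlim : Tendsto (norlundConst τ) atTop atTop) {P : Measure ℝ} (hP : IsProbabilityMeasure P)
    (hQ : ∀ j k : ℕ, Q j k Set.univ = ENNReal.ofReal (k + 1))
    (hF : ∀ (f : ℝ → ℝ) (B : ℝ), Continuous f → (∀ x, |f x| ≤ B) → ∀ ε > 0, ∃ C : ℝ,
      ∀ j k : ℕ, |∫ x, f x ∂(Q j k) - (k + 1) * ∫ x, f x ∂P| ≤ ε * (k + 1) + C) :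
    ConvergesWeakly (norlundMean σ τ Q) P := by
  refine ⟨h.isProbabilityMeasure_norlundMean hQ, hP,
    ProbabilityMeasure.tendsto_iff_forall_integral_tendsto.2 fun f => ?_⟩
  have hfin : ∀ j k, IsFiniteMeasure (Q j k) := fun j k => ⟨by rw [hQ]; exact ENNReal.ofReal_lt_top⟩
  have := h.tendsto_mean hlim (F := fun j k => ∫ x, f x ∂(Q j k))
    (hF f ‖f‖ f.continuous f.norm_coe_le_norm)
  refine this.congr fun n => ?_
  exact (h.integral_norlundMean (fun j k => f.integrable _) n).symm

end IsRegularNorlund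

/-- On probability measures living on a common bounded interval, weak convergence tests against all
continuous functions, since these may be truncated outside the interval. -/
theorem ConvergesWeakly.tendsto_integral_of_ae_abs_le {m : ℕ → Measure ℝ} {m₀ : Measure ℝ}
    (h : ConvergesWeakly m m₀) {R : ℝ} (hm : ∀ n, ∀ᵐ x ∂(m n), |x| ≤ R)
    (hm₀ : ∀ᵐ x ∂m₀, |x| ≤ R) {f : ℝ → ℝ} (hf : Continuous f) :
    Tendsto (fun n => ∫ x, f x ∂(m n)) atTop (𝓝 (∫ x, f x ∂m₀)) := by
  obtain ⟨h1, h2, ht⟩ := h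
  have hR : -R ≤ R := by
    obtain ⟨x, hx⟩ := hm₀.exists
    linarith [(abs_nonneg x).trans hx]
  set g : ℝ → ℝ := fun x => f (Set.projIcc (-R) R hR x) with hg
  have hgc : Continuous g := hf.comp (continuous_subtype_val.comp continuous_projIcc)
  obtain ⟨B, hB⟩ := (isCompact_Icc (a := -R) (b := R)).exists_bound_of_continuousOn hf.continuousOn
  have hgB : ∀ x, ‖g x‖ ≤ B := fun x => hB _ (Set.projIcc (-R) R hR x).2
  have hfg : ∀ x, |x| ≤ R → g x = f x := fun x hx => by
    simp only [hg, Set.projIcc_of_mem hR (abs_le.1 hx)]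
  have := ProbabilityMeasure.tendsto_iff_forall_integral_tendsto.1 ht
    (BoundedContinuousFunction.ofNormedAddCommGroup g hgc B hgB)
  have e : ∀ Q : Measure ℝ, (∀ᵐ x ∂Q, |x| ≤ R) → ∫ x, g x ∂Q = ∫ x, f x ∂Q := fun Q hQ =>
    integral_congr_ae (hQ.mono hfg)
  rw [← e _ hm₀]
  simp only [← e _ (hm _)]
  exact this

/-! ### Bounded recurrence coefficients -/

namespace IsAdmissible

variable {μ : Measure ℝ} {M : ℝ}

theorem abs_jacobiPow_le (h : IsAdmissible μ)
    (hM : ∀ n, |recurrenceA μ n| ≤ M ∧ |recurrenceB μ n| ≤ M) (l m i : ℕ) :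
    |jacobiPow μ l m i| ≤ (3 * M) ^ m := by
  have hM0 : 0 ≤ M := (abs_nonneg _).trans (hM 0).1
  induction m generalizing i with
  | zero =>
    rw [h.jacobiPow_zero]
    split_ifs <;> simp
  | succ m ih =>
    rw [h.jacobiPow_succ]
    refine (abs_add_three _ _ _).trans ?_
    simp only [abs_mul]
    have h1 := mul_le_mul (hM (i + 1)).2 (ih (i + 1)) (abs_nonneg _) hM0
    have h2 := mul_le_mul (hM i).1 (ih i) (abs_nonneg _) hM0
    have h3 := mul_le_mul (hM i).2 (ih (i - 1)) (abs_nonneg _) hM0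
    rw [pow_succ]
    linarith

/-- Even moments of `μ` grow at most like `(3M)^{2m}`, so `μ` has no mass outside
`[-(3M+1), 3M+1]`. -/
theorem ae_abs_le (h : IsAdmissible μ)
    (hM : ∀ n, |recurrenceA μ n| ≤ M ∧ |recurrenceB μ n| ≤ M) :
    ∀ᵐ x ∂μ, |x| ≤ 3 * M + 1 := by
  have := h.finite
  have hM0 : 0 ≤ M := (abs_nonneg _).trans (hM 0).1
  set R := 3 * M + 1 with hR
  have hR0 : 0 < R := by positivity
  obtain ⟨c, hc, hp0⟩ := h.eval_orthoPoly_zero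
  have hbound : ∀ m : ℕ, μ.real {x | R < |x|} ≤ (c ^ 2)⁻¹ * ((3 * M / R) ^ 2) ^ m := by
    intro m
    have h1 := (abs_le.1 (h.abs_jacobiPow_le hM 0 (2 * m) 0)).2
    simp only [jacobiPow, hp0] at h1
    rw [integral_mul_const] at h1
    have h2 := mul_meas_ge_le_integral_of_nonneg (μ := μ) (f := fun x => x ^ (2 * m))
      (Eventually.of_forall fun x => (even_two_mul m).pow_nonneg x)
      (h.integrable_continuous (by fun_prop)) (R ^ (2 * m))
    have h3 : μ.real {x | R < |x|} ≤ μ.real {x | R ^ (2 * m) ≤ x ^ (2 * m)} := by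
      refine measureReal_mono fun x (hx : R < |x|) => ?_
      change R ^ (2 * m) ≤ x ^ (2 * m)
      rw [← (even_two_mul m).pow_abs x]
      exact pow_le_pow_left₀ hR0.le hx.le _
    have hc2 : 0 < c ^ 2 := by positivity
    have hRm : 0 < R ^ (2 * m) := by positivity
    rw [← pow_mul, div_pow, inv_mul_eq_div, le_div_iff₀ hc2, le_div_iff₀ hRm]
    calc μ.real {x | R < |x|} * c ^ 2 * R ^ (2 * m)
        = R ^ (2 * m) * μ.real {x | R < |x|} * c ^ 2 := by ring
      _ ≤ R ^ (2 * m) * μ.real {x | R ^ (2 * m) ≤ x ^ (2 * m)} * c ^ 2 := by gcongr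
      _ ≤ (∫ x, x ^ (2 * m) ∂μ) * c ^ 2 := by gcongr
      _ ≤ (3 * M) ^ (2 * m) := by rw [sq]; exact h1
  have hlt : (3 * M / R) ^ 2 < 1 := by
    refine pow_lt_one₀ (by positivity) ?_ two_ne_zero
    rw [div_lt_one hR0]
    linarith
  have ht := (tendsto_pow_atTop_nhds_zero_of_lt_one (by positivity) hlt).const_mul (c ^ 2)⁻¹
  rw [mul_zero] at ht
  have h0 := le_antisymm (ge_of_tendsto' ht hbound) measureReal_nonneg
  rw [measureReal_eq_zero_iff] at h0
  rw [ae_iff]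
  simpa only [not_le] using h0

/-- At a zero `x` of `p_n`, evaluate the recurrence at an index `i < n` where `|p_i(x)|` is
maximal. -/
theorem abs_le_of_mem_roots (h : IsAdmissible μ)
    (hM : ∀ n, |recurrenceA μ n| ≤ M ∧ |recurrenceB μ n| ≤ M) {n : ℕ} {x : ℝ}
    (hx : (orthoPoly μ n).eval x = 0) : |x| ≤ 3 * M := by
  have hM0 : 0 ≤ M := (abs_nonneg _).trans (hM 0).1
  obtain ⟨c, hc, hp0⟩ := h.eval_orthoPoly_zero
  have hn : n ≠ 0 := by
    rintro rfl
    exact hc ((hp0 x).symm.trans hx)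
  obtain ⟨i, hi, hmax⟩ := Finset.exists_max_image (Finset.range n)
    (fun i => |(orthoPoly μ i).eval x|) ⟨0, Finset.mem_range.2 (by omega)⟩
  have hi' := Finset.mem_range.1 hi
  have hpos : 0 < |(orthoPoly μ i).eval x| := by
    refine lt_of_lt_of_le ?_ (hmax 0 (Finset.mem_range.2 (by omega)))
    rw [hp0]
    exact abs_pos.2 hc
  have hnext : |(orthoPoly μ (i + 1)).eval x| ≤ |(orthoPoly μ i).eval x| := by
    rcases Nat.lt_or_ge (i + 1) n with h1 | h1
    · exact hmax _ (Finset.mem_range.2 h1)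
    · rw [show i + 1 = n by omega, hx, abs_zero]
      exact hpos.le
  have hprev : |(orthoPoly μ (i - 1)).eval x| ≤ |(orthoPoly μ i).eval x| :=
    hmax _ (Finset.mem_range.2 (by omega))
  have hrec := congrArg abs (h.recurrence_eval i x)
  rw [abs_mul] at hrec
  have h0 := abs_add_three (recurrenceB μ (i + 1) * (orthoPoly μ (i + 1)).eval x)
    (recurrenceA μ i * (orthoPoly μ i).eval x) (recurrenceB μ i * (orthoPoly μ (i - 1)).eval x)
  rw [← hrec] at h0
  simp only [abs_mul] at h0
  have h1 := mul_le_mul (hM (i + 1)).2 hnext (abs_nonneg _) hM0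
  have h2 := mul_le_mul_of_nonneg_right (hM i).1 hpos.le
  have h3 := mul_le_mul (hM i).2 hprev (abs_nonneg _) hM0
  refine le_of_mul_le_mul_right ?_ hpos
  linarith

end IsAdmissible

/-! ### The two mean measures -/

theorem cdMean_eq_norlundMean (μ : ℕ → Measure ℝ) (σ τ : ℕ → ℝ) :
    cdMean μ σ τ =
      norlundMean σ τ fun j k => ∑ l ∈ Finset.range (k + 1), orthoDensity (μ j) l := by
  ext1 n
  simp only [cdMean, norlundMean, withDensity_cdKernel]

theorem zeroMean_eq_norlundMean (μ : ℕ → Measure ℝ) (σ τ : ℕ → ℝ) :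
    zeroMean μ σ τ = norlundMean σ τ fun j k =>
      ∑ x ∈ (orthoPoly (μ j) (k + 1)).roots.toFinset, Measure.dirac x := rfl

theorem convergesWeakly_cdMean {μ : ℕ → Measure ℝ} (hμ : ∀ k, IsAdmissible (μ k))
    {a b : ℝ} (hb : 0 < b) (hN : UniformNevai μ a b) {σ τ : ℕ → ℝ} (hS : IsRegularNorlund σ τ)
    (hlim : Tendsto (norlundConst τ) atTop atTop) :
    ConvergesWeakly (cdMean μ σ τ) (arcsineMeasure a b) := by
  rw [cdMean_eq_norlundMean]
  have hprob := fun j l => (hμ j).isProbabilityMeasure_orthoDensity l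
  refine hS.convergesWeakly_norlundMean hlim (isProbabilityMeasure_arcsineMeasure hb) ?_ ?_
  · intro j k
    rw [Measure.finsetSum_apply, Finset.sum_congr rfl fun l _ => (hprob j l).measure_univ,
      Finset.sum_const, Finset.card_range, nsmul_one, ← Nat.cast_succ, ENNReal.ofReal_natCast]
  · intro f B hf hB ε hε
    obtain ⟨C, hC⟩ := hN.exists_abs_sum_orthoDensity_sub_le hμ hb hf hB hε
    refine ⟨C, fun j k => ?_⟩
    rw [integral_finsetSum_measure fun l _ => (hμ j).integrable_orthoDensity l hf]
    exact hC j k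

theorem convergesWeakly_zeroMean {μ : ℕ → Measure ℝ} (hμ : ∀ k, IsAdmissible (μ k))
    {a b : ℝ} (hb : 0 < b) (hN : UniformNevai μ a b) {σ τ : ℕ → ℝ} (hS : IsRegularNorlund σ τ)
    (hlim : Tendsto (norlundConst τ) atTop atTop) :
    ConvergesWeakly (zeroMean μ σ τ) (arcsineMeasure a b) := by
  rw [zeroMean_eq_norlundMean]
  refine hS.convergesWeakly_norlundMean hlim (isProbabilityMeasure_arcsineMeasure hb) ?_ ?_
  · intro j k
    rw [Measure.finsetSum_apply, Finset.sum_congr rfl fun x _ => measure_univ,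
      Finset.sum_const, (hμ j).card_roots_toFinset, nsmul_one, ← Nat.cast_succ,
      ENNReal.ofReal_natCast]
  · intro f B hf hB ε hε
    obtain ⟨C, hC⟩ := hN.exists_abs_sum_roots_sub_le hμ hb hf hB hε
    refine ⟨C, fun j k => ?_⟩
    rw [integral_finsetSum_measure fun x _ => integrable_dirac (by simp)]
    simp only [integral_dirac]
    exact hC j k

theorem mainTheorem7 (μ : ℕ → Measure ℝ) (hμ : ∀ k, IsAdmissible (μ k))
    (a b : ℝ) (hb : 0 < b) (hN : UniformNevai μ a b)
    (σ τ : ℕ → ℝ) (hS : IsRegularNorlund σ τ)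
    (hlim : Tendsto (norlundConst τ) atTop atTop) :
    ConvergesWeakly (cdMean μ σ τ) (arcsineMeasure a b) ∧
    ConvergesWeakly (zeroMean μ σ τ) (arcsineMeasure a b) ∧
    ((∃ M : ℝ, ∀ n k, |recurrenceA (μ k) n| ≤ M ∧ |recurrenceB (μ k) n| ≤ M) →
      ∀ f : ℝ → ℝ, Continuous f →
        Tendsto (fun n => ∫ x, f x ∂(cdMean μ σ τ n)) atTop (𝓝 (∫ x, f x ∂(arcsineMeasure a b))) ∧
        Tendsto (fun n => ∫ x, f x ∂(zeroMean μ σ τ n)) atTop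
          (𝓝 (∫ x, f x ∂(arcsineMeasure a b)))) := by
  have hcd := convergesWeakly_cdMean hμ hb hN hS hlim
  have hz := convergesWeakly_zeroMean hμ hb hN hS hlim
  refine ⟨hcd, hz, fun ⟨M, hM⟩ f hf => ?_⟩
  have hP : ∀ᵐ x ∂(arcsineMeasure a b), |x| ≤ max (3 * M + 1) (|a| + 2 * b) :=
    (ae_abs_le_arcsineMeasure hb).mono fun x hx => hx.trans (le_max_right _ _)
  refine ⟨hcd.tendsto_integral_of_ae_abs_le (fun n => ?_) hP hf,
    hz.tendsto_integral_of_ae_abs_le (fun n => ?_) hP hf⟩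
  · rw [cdMean_eq_norlundMean]
    refine IsRegularNorlund.ae_norlundMean (fun j k => ?_) n
    rw [← withDensity_cdKernel]
    refine (withDensity_absolutelyContinuous _ _).ae_le ?_
    exact ((hμ j).ae_abs_le fun n => hM n j).mono fun x hx => hx.trans (le_max_left _ _)
  · rw [zeroMean_eq_norlundMean]
    refine IsRegularNorlund.ae_norlundMean (fun j k => ?_) n
    rw [ae_iff, Measure.finsetSum_apply]
    refine Finset.sum_eq_zero fun x hx => ?_
    rw [Measure.dirac_apply, Set.indicator_of_notMem]
    rw [Set.mem_ofPred_eq, not_not]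
    have hroot : (orthoPoly (μ j) (k + 1)).eval x = 0 :=
      (mem_roots'.1 (Multiset.mem_toFinset.1 hx)).2
    exact ((hμ j).abs_le_of_mem_roots (fun n => hM n j) hroot).trans
      ((by linarith : 3 * M ≤ 3 * M + 1).trans (le_max_left _ _))
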